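/- **Setting.** Let $\mathcal V\neq\emptyset$ (names) and $\Sigma$ (internal states) be countable sets. A *graph* is a finite set $G$ of systems $\sigma.v$ ($\sigma\in\Sigma$, $v\in\mathcal V$) in which each name carries at most one state; $V(G)$ is the set of names occurring in $G$, $\mathcal G$ the set of graphs, and $\mathcal H=\ell^2(\mathcal G)$ the Hilbert space with orthonormal basis $(|G\rangle)_{G\in\mathcal G}$. A *restriction* is a map $\chi:\mathcal G\to\mathcal G$, $G\mapsto G_\chi\subseteq G$, such that $G_\chi\subseteq H\subseteq G$ implies $H_\chi=G_\chi$. Write $G_{\overline\chi}=G\setminus G_\chi$ and $G_{\chi\zeta}=(G_\chi)_\zeta$. Write $\zeta\sqsubseteq\chi$ if for all $G,H$: $G_{\chi\zeta}=G_\zeta$ and $\langle H_{\overline\zeta}|G_{\overline\zeta}\rangle=\langle H_{\chi\overline\zeta}|G_{\chi\overline\zeta}\rangle\langle H_{\overline\chi}|G_{\overline\chi}\rangle$. The *$\chi$-trace* $\rho\mapsto\rho_{|\chi}$ on trace class operators is the continuous linear extension of $(|G\rangle\langle H|)_{|\chi}=|G_\chi\rangle\langle H_\chi|\,\langle H_{\overline\chi}|G_{\overline\chi}\rangle$.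 A bounded operator $A$ on $\mathcal H$ is - *$\chi$-local* if $\langle H|A|G\rangle=\langle H_\chi|A|G_\chi\rangle\langle H_{\overline\chi}|G_{\overline\chi}\rangle$ for all $G,H$; - *strictly $\chi$-local* if moreover, for all $G,H$, each of $\langle H|A|G_\chi\rangle\ne0$ and $\langle H|A^\dagger|G_\chi\rangle\neq0$ implies that there is a graph $G'$ with $G'_\chi=H$ and $G'_{\overline\chi}=G_{\overline\chi}$; - *$\chi\zeta$-causal* if $(A\rho A^\dagger)_{|\zeta}=(A\rho_{|\chi}A^\dagger)_{|\zeta}$ for every trace class $\rho$; - *name-preserving* if $\langle H|A|G\rangle=0$ whenever $V(G)\neq V(H)$. For $v\in\mathcal V$ let $\zeta_v$ be the restriction that keeps exactly the system named $v$ (if any). Let $\Sigma'=\{0,1\}\times\Sigma$, with graphs $\mathcal G'$ and Hilbert space $\mathcal H'$, and define restrictions of $\mathcal G'$, in particular $\zeta_v$, and locality on $\mathcal H'$ in the same way. Let $\mu$ be the restriction of $\mathcal G'$ that keeps exactly the systems $b.\sigma.u$ with $b=0$. The graphs in $\mathcal G'$ all of whose bits are $0$ are identified with $\mathcal G$, and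 the closed span $\mathcal H'_\mu$ of their basis vectors with $\mathcal H$. For a restriction $\chi_v$ of $\mathcal G$, let $\xi_v=\mu\chi_v\cup\overline\mu\zeta_v$ be the restriction of $\mathcal G'$ given by $G_{\xi_v}=(G_\mu)_{\chi_v}\cup(G_{\overline\mu})_{\zeta_v}$, where $G_\mu$ is viewed as an element of $\mathcal G$. **Theorem (Block decomposition).** For each $v\in\mathcal V$ let $\chi_v$ and $\zeta'_v$ be restrictions of $\mathcal G$ with $\zeta_v\sqsubseteq\zeta'_v$. Let $U$ be a name-preserving unitary operator on $\mathcal H$ that is $\chi_v\zeta'_v$-causal for every $v\in\mathcal V$. Then there are, for all $v\in\mathcal V$, a strictly $\zeta_v$-local unitary $\tau_v$ and a strictly $\xi_v$-local unitary $K_v$ on $\mathcal H'$ such that $[\tau_x,\tau_y]=[K_x,K_y]=0$ for all $x,y\in\mathcal V$, the products $\prod_{v\in\mathcal V}\tau_v$ and $\prod_{v\in\mathcal V}K_v$ exist (as strong operator limits of the products over finite subsets of $\mathcal V$), and $$\Big(\prod_{v\in\mathcal V}\tau_v\Big)\Big(\prod_{v\in\mathcal V}K_v\Big)|\psi\rangle=U|\psi\rangle\qquad\text{for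 all }|\psi\rangle\in\mathcal H'_\mu\cong\mathcal H .$$ -/

import Mathlib

open scoped ComplexInnerProductSpace
open Filter Topology

noncomputable section

namespace NamedGraph

/-! ### Graphs -/

/-- A graph over internal states `S` and names `V`: a finite set of systems `σ.v` (pairs `(σ, v)`)
in which every name carries at most one internal state. -/
@[ext]
structure SysGraph (S V : Type*) where
  carrier : Set (S × V)
  finite : carrier.Finite
  wellNamed : ∀ (σ σ' : S) (v : V), (σ, v) ∈ carrier → (σ', v) ∈ carrier → σ = σ'

namespace SysGraph

variable {S V : Type*}

/-- The support `V(G)`: the set of names occurring in `G`. -/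
def support (G : SysGraph S V) : Set V := Prod.snd '' G.carrier

/-- A set of systems contained in a graph is a graph. -/
def ofSubset (G : SysGraph S V) (s : Set (S × V)) (h : s ⊆ G.carrier) : SysGraph S V where
  carrier := s
  finite := G.finite.subset h
  wellNamed σ σ' v h₁ h₂ := G.wellNamed σ σ' v (h h₁) (h h₂)

/-- The set difference `G \ H`. -/
def diff (G H : SysGraph S V) : SysGraph S V :=
  G.ofSubset (G.carrier \ H.carrier) Set.sdiff_subset

end SysGraph

/-! ### Restrictions -/

/-- A restriction: a map `G ↦ G_χ ⊆ G` such that `G_χ ⊆ H ⊆ G` implies `H_χ = G_χ`. -/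
@[ext]
structure Restriction (S V : Type*) where
  toFun : SysGraph S V → SysGraph S V
  subset : ∀ G, (toFun G).carrier ⊆ G.carrier
  stable : ∀ G H, (toFun G).carrier ⊆ H.carrier → H.carrier ⊆ G.carrier → toFun H = toFun G

namespace Restriction

variable {S V : Type*}

instance : CoeFun (Restriction S V) (fun _ => SysGraph S V → SysGraph S V) := ⟨toFun⟩

/-- The complement `G ↦ G \ G_χ` (in general not a restriction). -/
def compl (χ : Restriction S V) (G : SysGraph S V) : SysGraph S V := G.diff (χ G)

/-- The pointwise restriction that keeps exactly the systems satisfying `p`. -/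
def pointwise (p : S × V → Prop) : Restriction S V where
  toFun G := G.ofSubset {s | s ∈ G.carrier ∧ p s} fun _ h => h.1
  subset _ _ h := h.1
  stable G H h₁ h₂ := by
    ext s
    exact ⟨fun h => ⟨h₂ h.1, h.2⟩, fun h => ⟨h₁ h, h.2⟩⟩

/-- `ζ_v`: keeps the system named `v`. -/
def atName (v : V) : Restriction S V := pointwise fun s => s.2 = v

end Restriction

/-! ### The Hilbert space and its operators -/

/-- The Hilbert space `ℓ²(𝒢)` whose canonical orthonormal basis is labelled by the graphs. -/
abbrev GraphSpace (S V : Type*) := lp (fun _ : SysGraph S V => ℂ) 2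

/-- Bounded operators on the graph Hilbert space. -/
abbrev Op (S V : Type*) := GraphSpace S V →L[ℂ] GraphSpace S V

open Classical in
/-- The canonical basis vector `|G⟩`. -/
def ket {S V : Type*} (G : SysGraph S V) : GraphSpace S V := lp.single 2 G (1 : ℂ)

/-- For a map `f` from `β` to `α ∪ {none}` that is injective where it is defined, the contraction
`ℓ²(α) → ℓ²(β)` given by `(pull f ψ) b = ψ (f b)` where `f b` is defined, and `0` elsewhere. -/
def pull {α β : Type*} (f : β → Option α)
    (hf : ∀ b b' a, f b = some a → f b' = some a → b = b') :
    lp (fun _ : α => ℂ) 2 →L[ℂ] lp (fun _ : β => ℂ) 2 :=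
  have key : ∀ (ψ : lp (fun _ : α => ℂ) 2) (s : Finset β),
      ∑ b ∈ s, ‖(f b).elim 0 ψ‖ ^ (2 : ENNReal).toReal ≤ ‖ψ‖ ^ (2 : ENNReal).toReal := by
    classical
    intro ψ s
    have h₁ : ∑ b ∈ s, ‖(f b).elim 0 ψ‖ ^ (2 : ENNReal).toReal
        = ∑ b ∈ s with (f b).isSome, ‖(f b).elim 0 ψ‖ ^ (2 : ENNReal).toReal := by
      symm
      apply Finset.sum_filter_of_ne
      intro b _ hb
      cases h : f b with
      | none => simp [h] at hb
      | some a => rfl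
    have h₂ : ∑ b ∈ s with (f b).isSome, ‖(f b).elim 0 ψ‖ ^ (2 : ENNReal).toReal
        = ∑ a ∈ s.filterMap f fun b b' a h h' => hf b b' a h h',
            ‖ψ a‖ ^ (2 : ENNReal).toReal := by
      refine Finset.sum_bij' (fun b hb => (f b).get (Finset.mem_filter.1 hb).2)
        (fun a ha => ((Finset.mem_filterMap f).1 ha).choose) ?_ ?_ ?_ ?_ ?_
      · intro b hb
        exact (Finset.mem_filterMap f).2 ⟨b, (Finset.mem_filter.1 hb).1, by simp⟩
      · intro a ha
        have h := ((Finset.mem_filterMap f).1 ha).choose_spec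
        exact Finset.mem_filter.2 ⟨h.1, by simp [h.2]⟩
      · intro b hb
        generalize_proofs _ h
        exact hf _ _ _ h.choose_spec.2 (by simp)
      · intro a ha
        generalize_proofs h₁ h₂
        simp [h₁.choose_spec.2]
      · intro b hb
        obtain ⟨a, ha⟩ := Option.isSome_iff_exists.1 (Finset.mem_filter.1 hb).2
        simp [ha]
    rw [h₁, h₂]
    exact lp.sum_rpow_le_norm_rpow (by norm_num) ψ _
  LinearMap.mkContinuous
    { toFun := fun ψ => ⟨fun b => (f b).elim 0 ψ, memℓp_gen' (key ψ)⟩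
      map_add' := fun ψ φ => by
        ext b
        change (f b).elim 0 (ψ + φ : lp (fun _ : α => ℂ) 2) = (f b).elim 0 ψ + (f b).elim 0 φ
        cases f b with
        | none => exact (add_zero 0).symm
        | some a => rfl
      map_smul' := fun c ψ => by
        ext b
        change (f b).elim 0 (c • ψ : lp (fun _ : α => ℂ) 2) = c • (f b).elim 0 ψ
        cases f b with
        | none => exact (smul_zero c).symm
        | some a => rfl }
    1 (fun ψ => by
      rw [one_mul]
      exact lp.norm_le_of_forall_sum_le (by norm_num) (norm_nonneg _) (key ψ))

@[simp]
theorem pull_apply {α β : Type*} (f : β → Option α)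
    (hf : ∀ b b' a, f b = some a → f b' = some a → b = b')
    (ψ : lp (fun _ : α => ℂ) 2) (b : β) : pull f hf ψ b = (f b).elim 0 ψ := rfl

/-! ### Tensors and traceouts -/

namespace Restriction

variable {S V : Type*}

open Classical in
/-- The graph `G` with `G_χ = L` and `G \ G_χ = R`, if there is one (it is then `L ∪ R`). -/
def weave (χ : Restriction S V) (L R : SysGraph S V) : Option (SysGraph S V) :=
  if h : ∃ G, χ G = L ∧ χ.compl G = R then some h.choose else none

/-- The tensor `|L⟩ ⊗_χ |R⟩` of two basis vectors. -/
def tensor (χ : Restriction S V) (L R : SysGraph S V) : GraphSpace S V :=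
  (χ.weave L R).elim 0 ket

theorem weave_eq_some {χ : Restriction S V} {L R G : SysGraph S V} (h : χ.weave L R = some G) :
    χ G = L ∧ χ.compl G = R := by
  unfold weave at h
  split_ifs at h with h'
  obtain rfl := Option.some.inj h
  exact h'.choose_spec

theorem carrier_eq_union (χ : Restriction S V) (G : SysGraph S V) :
    G.carrier = (χ G).carrier ∪ (χ.compl G).carrier :=
  (Set.union_sdiff_cancel (χ.subset G)).symm

theorem weave_self (χ : Restriction S V) (G : SysGraph S V) :
    χ.weave (χ G) (χ.compl G) = some G := by
  have h : ∃ G', χ G' = χ G ∧ χ.compl G' = χ.compl G := ⟨G, rfl, rfl⟩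
  rw [weave, dif_pos h]
  congr 1
  ext1
  rw [carrier_eq_union χ G, carrier_eq_union χ h.choose, h.choose_spec.1, h.choose_spec.2]

/-- The operator `|G⟩ ↦ |G_χ⟩ ⟨K|G \ G_χ⟩`, i.e. the adjoint of `|L⟩ ↦ |L⟩ ⊗_χ |K⟩`. -/
def contract (χ : Restriction S V) (K : SysGraph S V) : Op S V :=
  pull (fun L => χ.weave L K) fun _ _ _ h h' => (weave_eq_some h).1.symm.trans (weave_eq_some h').1

/-- The `χ`-trace `ρ ↦ ρ_{|χ}`. On matrix units it is
`|G⟩⟨H| ↦ |G_χ⟩⟨H_χ| ⟨H \ H_χ|G \ G_χ⟩` (see `traceOut_rankOne`), extended linearly and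
continuously: `ρ_{|χ} = ∑_K T_K ρ T_K†` with `T_K = χ.contract K`, a series that converges
absolutely for every trace class `ρ`. -/
def traceOut (χ : Restriction S V) (ρ : Op S V) : Op S V :=
  ∑' K : SysGraph S V, χ.contract K ∘L ρ ∘L (χ.contract K).adjoint

theorem contract_ket (χ : Restriction S V) (K G : SysGraph S V) :
    χ.contract K (ket G) = (⟪ket K, ket (χ.compl G)⟫ : ℂ) • ket (χ G) := by
  classical
  ext L
  rw [lp.coeFn_smul, Pi.smul_apply]
  simp only [contract, pull_apply, ket, lp.inner_single_left, lp.single_apply, Pi.single_apply]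
  cases h : χ.weave L K with
  | none =>
    by_cases h₁ : K = χ.compl G
    · by_cases h₂ : L = χ G
      · rw [h₁, h₂, weave_self] at h
        cases h
      · simp [h₂]
    · simp [h₁]
  | some G' =>
    obtain ⟨rfl, rfl⟩ := weave_eq_some h
    by_cases h₁ : G' = G
    · simp [h₁, lp.single_apply]
    · have : ¬ (χ.compl G' = χ.compl G ∧ χ G' = χ G) := fun ⟨ha, hb⟩ => by
        rw [ha, hb, weave_self] at h
        exact h₁ (Option.some.inj h).symm
      simp only [Option.elim, lp.single_apply, Pi.single_apply, h₁]
      by_cases ha : χ.compl G' = χ.compl G <;> by_cases hb : χ G' = χ G <;> simp_all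

theorem traceOut_rankOne (χ : Restriction S V) (G H : SysGraph S V) :
    χ.traceOut (InnerProductSpace.rankOne ℂ (ket G) (ket H)) =
      (⟪ket (χ.compl H), ket (χ.compl G)⟫ : ℂ) •
        InnerProductSpace.rankOne ℂ (ket (χ G)) (ket (χ H)) := by
  classical
  have h : ∀ K : SysGraph S V, χ.contract K ∘L InnerProductSpace.rankOne ℂ (ket G) (ket H) ∘L
      (χ.contract K).adjoint = ((⟪ket K, ket (χ.compl G)⟫ : ℂ) * ⟪ket (χ.compl H), ket K⟫) •
        InnerProductSpace.rankOne ℂ (ket (χ G)) (ket (χ H)) := by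
    intro K
    ext1 ψ
    simp only [ContinuousLinearMap.comp_apply, InnerProductSpace.rankOne_apply,
      ContinuousLinearMap.adjoint_inner_right, contract_ket, inner_smul_left, map_smul,
      smul_apply, inner_conj_symm, smul_smul]
    congr 1
    ring
  unfold traceOut
  simp_rw [h]
  rw [tsum_eq_single (χ.compl G)]
  · simp [ket, lp.inner_single_left]
  · intro K hK
    have : (⟪ket K, ket (χ.compl G)⟫ : ℂ) = 0 := by
      simp [ket, lp.inner_single_left, lp.single_apply, hK]
    rw [this, zero_mul, zero_smul]

/-- `ζ ⊑ χ`, "`ζ` is comprehended within `χ`". -/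
def Comprehended (ζ χ : Restriction S V) : Prop :=
  (∀ G, ζ (χ G) = ζ G) ∧
  ∀ G H, (⟪ket (ζ.compl H), ket (ζ.compl G)⟫ : ℂ) =
    ⟪ket (ζ.compl (χ H)), ket (ζ.compl (χ G))⟫ * ⟪ket (χ.compl H), ket (χ.compl G)⟫

end Restriction

/-! ### Locality, causality, name-preservation -/

/-- The absolute value `|A| = √(A† A)` of a bounded operator on a Hilbert space. -/
def absOp {E : Type*} [NormedAddCommGroup E] [InnerProductSpace ℂ E] [CompleteSpace E]
    (A : E →L[ℂ] E) : E →L[ℂ] E := CFC.abs A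

section Operators

variable {S V : Type*}

/-- The matrix entry `⟨H| A |G⟩`. -/
def entry (A : Op S V) (H G : SysGraph S V) : ℂ := ⟪ket H, A (ket G)⟫

/-- `A` is `χ`-local: `⟨H|A|G⟩ = ⟨H_χ|A|G_χ⟩ ⟨H \ H_χ|G \ G_χ⟩`. -/
def IsLocal (χ : Restriction S V) (A : Op S V) : Prop :=
  ∀ G H, entry A H G = entry A (χ H) (χ G) * ⟪ket (χ.compl H), ket (χ.compl G)⟫

/-- `A` is `χ`-consistent-preserving. -/
def IsConsistentPreserving (χ : Restriction S V) (A : Op S V) : Prop :=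
  ∀ G H, (entry A H (χ G) ≠ 0 → χ.tensor H (χ.compl G) ≠ 0) ∧
    (entry A.adjoint H (χ G) ≠ 0 → χ.tensor H (χ.compl G) ≠ 0)

/-- `A` is strictly `χ`-local. -/
def IsStrictlyLocal (χ : Restriction S V) (A : Op S V) : Prop :=
  IsLocal χ A ∧ IsConsistentPreserving χ A

/-- `ρ` is trace class: `|ρ| = √(ρ† ρ)` has finite trace in the canonical orthonormal basis. -/
def IsTraceClass (ρ : Op S V) : Prop :=
  Summable fun G : SysGraph S V => (entry (absOp ρ) G G).re

/-- `U` is `χζ`-causal: `(U ρ U†)_{|ζ} = (U ρ_{|χ} U†)_{|ζ}` for every trace class `ρ`. -/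
def IsCausal (χ ζ : Restriction S V) (U : Op S V) : Prop :=
  ∀ ρ : Op S V, IsTraceClass ρ →
    ζ.traceOut (U ∘L ρ ∘L U.adjoint) = ζ.traceOut (U ∘L χ.traceOut ρ ∘L U.adjoint)

/-- `A` is name-preserving. -/
def IsNamePreserving (A : Op S V) : Prop :=
  ∀ G H : SysGraph S V, G.support ≠ H.support → entry A H G = 0

/-- `P` is the product `∏_{v ∈ V} A_v` of a commuting family: the limit of the finite products,
along the directed set of finite subsets of `V`, in the strong operator topology. -/
def IsInfiniteProduct (A : V → Op S V) (comm : ∀ x y, Commute (A x) (A y)) (P : Op S V) : Prop :=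
  ∀ ψ : GraphSpace S V,
    Tendsto (fun F : Finset V => F.noncommProd A (fun x _ y _ _ => comm x y) ψ) atTop (𝓝 (P ψ))

end Operators

/-! ### The ancilla bit -/

section Ancilla

variable {S V : Type*}

/-- The graph `0.G` over `{0,1} × S`: every system gets ancilla bit `0`. -/
def SysGraph.addZero (G : SysGraph S V) : SysGraph (Fin 2 × S) V where
  carrier := (fun s : S × V => ((0, s.1), s.2)) '' G.carrier
  finite := G.finite.image _
  wellNamed := by
    rintro _ _ _ ⟨⟨σ, v⟩, h, ⟨⟩⟩ ⟨⟨σ', v'⟩, h', h''⟩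
    simp only [Prod.mk.injEq] at h''
    obtain ⟨rfl, rfl⟩ := h''
    rw [G.wellNamed _ _ _ h h']

/-- Forget the ancilla bits. -/
def SysGraph.forget (G : SysGraph (Fin 2 × S) V) : SysGraph S V where
  carrier := (fun s : (Fin 2 × S) × V => (s.1.2, s.2)) '' G.carrier
  finite := G.finite.image _
  wellNamed := by
    rintro _ _ _ ⟨⟨⟨b, σ⟩, v⟩, h, ⟨⟩⟩ ⟨⟨⟨b', σ'⟩, v'⟩, h', h''⟩
    simp only [Prod.mk.injEq] at h''
    obtain ⟨rfl, rfl⟩ := h''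
    exact (Prod.mk.inj (G.wellNamed _ _ _ h h')).2

/-- `μ`: keeps the systems with ancilla bit `0`. -/
def mu (S V : Type*) : Restriction (Fin 2 × S) V := .pointwise fun s => s.1.1 = 0

theorem mem_mu {G : SysGraph (Fin 2 × S) V} {s : (Fin 2 × S) × V} :
    s ∈ (mu S V G).carrier ↔ s ∈ G.carrier ∧ s.1.1 = 0 := Iff.rfl

theorem mem_mu_compl {G : SysGraph (Fin 2 × S) V} {s : (Fin 2 × S) × V} :
    s ∈ ((mu S V).compl G).carrier ↔ s ∈ G.carrier ∧ s.1.1 ≠ 0 := by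
  change s ∈ G.carrier ∧ ¬ (s ∈ G.carrier ∧ s.1.1 = 0) ↔ _
  tauto

theorem addZero_forget {G : SysGraph (Fin 2 × S) V} (h : mu S V G = G) :
    G.forget.addZero = G := by
  ext ⟨⟨b, σ⟩, v⟩
  have h0 : ∀ s ∈ G.carrier, s.1.1 = 0 := fun s hs => by
    rw [← h] at hs
    exact hs.2
  constructor
  · rintro ⟨_, ⟨⟨⟨b', σ'⟩, v'⟩, hs, rfl⟩, h'⟩
    simp only [Prod.mk.injEq] at h'
    obtain ⟨⟨rfl, rfl⟩, rfl⟩ := h'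
    have := h0 _ hs
    simp only at this
    rwa [this] at hs
  · intro hs
    have := h0 _ hs
    simp only at this
    subst this
    exact ⟨(σ, v), ⟨_, hs, rfl⟩, rfl⟩

theorem forget_addZero (G : SysGraph S V) : G.addZero.forget = G := by
  ext ⟨σ, v⟩
  simp [SysGraph.addZero, SysGraph.forget]

theorem addZero_mono {G H : SysGraph S V} :
    G.addZero.carrier ⊆ H.addZero.carrier ↔ G.carrier ⊆ H.carrier :=
  Set.image_subset_image_iff fun s t h => by
    simp only [Prod.mk.injEq, true_and] at h
    exact Prod.ext h.1 h.2

theorem mu_idem (G : SysGraph (Fin 2 × S) V) : mu S V (mu S V G) = mu S V G := by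
  ext s
  simp only [mem_mu]
  tauto

/-- Through the identification of graphs over `S` with graphs all of whose ancilla bits are `0`,
a restriction `χ` over `S` yields `μχ`: restrict to bit `0`, then apply `χ`. -/
def muThen (χ : Restriction S V) (G : SysGraph (Fin 2 × S) V) : SysGraph (Fin 2 × S) V :=
  (χ (mu S V G).forget).addZero

theorem muThen_subset (χ : Restriction S V) (G : SysGraph (Fin 2 × S) V) :
    (muThen χ G).carrier ⊆ (mu S V G).carrier := by
  conv_rhs => rw [← addZero_forget (mu_idem G)]
  exact addZero_mono.2 (χ.subset _)

/-- The restriction `ξ_v = μχ_v ∪ μ̄ζ_v` over `{0,1} × S`: apply `χ_v` to the part with bit `0`,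
and `ζ_v` to the part with bit `1`. -/
def xi (χ : Restriction S V) (v : V) : Restriction (Fin 2 × S) V where
  toFun G := G.ofSubset
    ((muThen χ G).carrier ∪ (Restriction.atName v ((mu S V).compl G)).carrier)
    (Set.union_subset ((muThen_subset χ G).trans ((mu S V).subset G))
      (((Restriction.atName v).subset _).trans Set.sdiff_subset))
  subset _ := Set.union_subset ((muThen_subset χ _).trans ((mu S V).subset _))
      (((Restriction.atName v).subset _).trans Set.sdiff_subset)
  stable G H h₁ h₂ := by
    have e₁ : muThen χ H = muThen χ G := by
      unfold muThen
      congr 1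
      apply χ.stable
      · rw [← addZero_mono, addZero_forget (mu_idem H)]
        intro s hs
        exact ⟨h₁ (Or.inl hs), (muThen_subset χ G hs).2⟩
      · rw [← addZero_mono, addZero_forget (mu_idem H), addZero_forget (mu_idem G)]
        exact fun s hs => ⟨h₂ hs.1, hs.2⟩
    have e₂ : Restriction.atName v ((mu S V).compl H) =
        Restriction.atName v ((mu S V).compl G) := by
      apply (Restriction.atName v).stable
      · intro s hs
        exact mem_mu_compl.2 ⟨h₁ (Or.inr hs), (mem_mu_compl.1 hs.1).2⟩
      · intro s hs
        exact mem_mu_compl.2 ⟨h₂ (mem_mu_compl.1 hs).1, (mem_mu_compl.1 hs).2⟩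
    ext1
    change (muThen χ H).carrier ∪ _ = (muThen χ G).carrier ∪ _
    rw [e₁, e₂]

open Classical in
/-- The isometric identification of `ℋ` with `ℋ'_μ ⊆ ℋ'` (the closed span of the graphs all of
whose ancilla bits are `0`), `|G⟩ ↦ |0.G⟩`. -/
def embed (S V : Type*) : GraphSpace S V →L[ℂ] GraphSpace (Fin 2 × S) V :=
  pull (fun G => if mu S V G = G then some G.forget else none) fun G H K hG hH => by
    split_ifs at hG hH with h h'
    rw [← addZero_forget h, ← addZero_forget h', Option.some.inj hG, Option.some.inj hH]

theorem embed_ket (G : SysGraph S V) : embed S V (ket G) = ket G.addZero := by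
  classical
  have hmu : mu S V G.addZero = G.addZero := by
    ext s
    refine ⟨fun h => h.1, fun h => ⟨h, ?_⟩⟩
    obtain ⟨_, _, rfl⟩ := h
    rfl
  ext H
  simp only [embed, pull_apply, ket, lp.single_apply, Pi.single_apply]
  by_cases h : mu S V H = H
  · have : H.forget = G ↔ H = G.addZero :=
      ⟨fun e => by rw [← e, addZero_forget h], fun e => by rw [e, forget_addZero]⟩
    simp [h, lp.single_apply, Pi.single_apply, this]
  · have : H ≠ G.addZero := fun e => h (e ▸ hmu)
    simp [h, this]

end Ancilla

end NamedGraph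

end

open NamedGraph

/-!
Let `c` be the phase by which `U` multiplies the empty graph (`exists_phase`), and let `W` be the
unitary on `ℋ'` that acts as `U` on the part of a graph with ancilla bit `0` and leaves the part
with bit `1` alone. It exists because `U` preserves names: the images of the basis vectors then
form a Hilbert basis (`exists_unitary_extension`). Take `τ_v` to be the operator toggling the bit
at `v`, and `K_v = W† τ_v W`. The finite products converge to the toggle `τ` of all bits
(`tendsto_toggleOp`) and to `W† τ W`. On a vector `ψ` with all bits `0`, the operator `W` acts as
`U`, then `τ` moves everything to bit `1`, where `W†` is the scalar `c⁻¹`, and the second `τ`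
moves everything back: `τ W† τ W ψ = c⁻¹ U ψ`. Multiplying `τ_v` by `c` at one single name `v`
removes the scalar.

The remaining point is locality. Strictness is automatic: a `χ`-local isometry `A` satisfies
`A|G⟩ = T† A|G_χ⟩`, where `T†` reattaches `G \ G_χ`. As `T†` is a partial isometry that does not
shrink the unit vector `A|G_χ⟩`, that vector lies in its initial space, which is spanned by the
`|H⟩` that fit together with `G \ G_χ` (`IsLocal.strict_of_unitary`). Locality of `K_v` is
causality in the Heisenberg picture: if `U` is `χζ`-causal and `A` is `ζ`-local then `U† A U` is
`χ`-local, since a `ζ`-local `A` has the same expectation on `ρ` and on `ρ_{|ζ}`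
(`IsCausal.isLocal_conj`). Between given parts with bit `1`, the toggle at `v` restricts to a
`ζ_v`-local operator on `ℋ` (`isLocal_toggleBlock`), namely the creation, the annihilation or the
absence of a system at `v`. Hence the corresponding blocks of `K_v` are `χ_v`-local, which gives
the `ξ_v`-locality of `K_v` (`isLocal_conj_toggleOp`).
-/

noncomputable section

namespace NamedGraph

/-! ### Operators in the graph basis -/

section Basis

variable {S V : Type*}

theorem inner_ket_left (G : SysGraph S V) (ψ : GraphSpace S V) : (⟪ket G, ψ⟫ : ℂ) = ψ G := by
  classical
  simp [ket, lp.inner_single_left]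

open Classical in
theorem ket_apply (G H : SysGraph S V) : (ket G) H = if H = G then (1 : ℂ) else 0 := by
  simp only [ket, lp.single_apply, Pi.single_apply]

open Classical in
theorem inner_ket_ket (H G : SysGraph S V) :
    (⟪ket H, ket G⟫ : ℂ) = if H = G then 1 else 0 := by
  rw [inner_ket_left, ket_apply]

theorem entry_eq_apply (A : Op S V) (H G : SysGraph S V) : entry A H G = A (ket G) H :=
  inner_ket_left _ _

theorem norm_ket (G : SysGraph S V) : ‖ket G‖ = 1 := by
  rw [@norm_eq_sqrt_re_inner ℂ, inner_ket_ket]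
  simp

theorem hasSum_ket (ψ : GraphSpace S V) : HasSum (fun G => ψ G • ket G) ψ := by
  classical
  have h := lp.hasSum_single (E := fun _ : SysGraph S V => ℂ) (p := 2) (by norm_num) ψ
  convert h using 2 with G
  ext H
  simp [ket, lp.single_apply, Pi.single_apply]

/-- A bounded operator is determined by its values on the basis vectors. -/
theorem ext_on_ket {E : Type*} [AddCommMonoid E] [TopologicalSpace E] [T2Space E] [Module ℂ E]
    {A B : GraphSpace S V →L[ℂ] E} (h : ∀ G, A (ket G) = B (ket G)) : A = B := by
  ext1 ψ
  have hA := (hasSum_ket ψ).mapL A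
  have hB := (hasSum_ket ψ).mapL B
  simp only [map_smul, h] at hA hB
  exact hA.unique hB

theorem entry_adjoint (A : Op S V) (H G : SysGraph S V) :
    entry A.adjoint H G = starRingEnd ℂ (entry A G H) := by
  rw [entry, entry, ContinuousLinearMap.adjoint_inner_right, inner_conj_symm]

/-- The sandwich `⟨x|A|y⟩` sees only the matrix entries of `A` between the basis vectors that occur
in `x` and those that occur in `y`. -/
theorem inner_congr_of_entry {A B : Op S V} {x y : GraphSpace S V}
    (h : ∀ M N, x M ≠ 0 → y N ≠ 0 → entry A M N = entry B M N) : (⟪x, A y⟫ : ℂ) = ⟪x, B y⟫ := by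
  have key : ∀ C : Op S V, ∀ M, HasSum (fun N => y N * entry C M N) (⟪ket M, C y⟫ : ℂ) := by
    intro C M
    have := ((hasSum_ket y).mapL C).mapL (innerSL ℂ (ket M))
    simpa [entry] using this
  have key₂ : ∀ C : Op S V,
      HasSum (fun M => (⟪ket M, C y⟫ : ℂ) * starRingEnd ℂ (x M)) (⟪x, C y⟫ : ℂ) := by
    intro C
    simp only [inner_ket_left]
    exact lp.hasSum_inner x (C y)
  refine (key₂ A).unique ?_
  convert key₂ B using 2 with M
  by_cases hM : x M = 0
  · simp [hM]
  · congr 1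
    refine (key A M).unique ?_
    convert key B M using 2 with N
    by_cases hN : y N = 0
    · simp [hN]
    · rw [h M N hM hN]

end Basis

/-! ### Local operators and strictness -/

section Contraction

variable {S V : Type*}

theorem IsLocal.adjoint {χ : Restriction S V} {A : Op S V} (h : IsLocal χ A) :
    IsLocal χ A.adjoint := by
  intro G H
  rw [entry_adjoint, entry_adjoint, h H G, map_mul, inner_conj_symm]

theorem isLocal_one (χ : Restriction S V) : IsLocal χ (1 : Op S V) := by
  classical
  intro G H
  simp only [entry, one_apply_eq_self, inner_ket_ket]
  by_cases h : H = G
  · simp [h]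
  · by_cases h₁ : χ H = χ G
    · by_cases h₂ : χ.compl H = χ.compl G
      · exfalso
        apply h
        ext1
        rw [χ.carrier_eq_union, h₁, h₂, ← χ.carrier_eq_union]
      · simp [h, h₂]
    · simp [h, h₁]

/-- A local operator acts on `|G⟩` by acting on `|G_χ⟩` and then reattaching the rest of `G`. -/
theorem IsLocal.apply_ket {χ : Restriction S V} {A : Op S V} (h : IsLocal χ A)
    (G : SysGraph S V) : (χ.contract (χ.compl G)).adjoint (A (ket (χ G))) = A (ket G) := by
  ext H
  rw [← inner_ket_left, ← inner_ket_left, ContinuousLinearMap.adjoint_inner_right,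
    Restriction.contract_ket, inner_smul_left, inner_conj_symm, mul_comm]
  exact (h G H).symm

theorem contract_norm_le (χ : Restriction S V) (K : SysGraph S V) (ψ : GraphSpace S V) :
    ‖χ.contract K ψ‖ ≤ ‖ψ‖ := by
  have h : ‖χ.contract K‖ ≤ 1 := by
    unfold Restriction.contract pull
    exact LinearMap.mkContinuous_norm_le _ zero_le_one _
  exact ((χ.contract K).le_of_opNorm_le h ψ).trans (one_mul _).le

theorem adjoint_contract_ket (χ : Restriction S V) (K L : SysGraph S V) :
    (χ.contract K).adjoint (ket L) = χ.tensor L K := by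
  classical
  ext H
  rw [← inner_ket_left, ContinuousLinearMap.adjoint_inner_right, Restriction.contract_ket,
    inner_smul_left, inner_conj_symm, inner_ket_ket, inner_ket_ket, Restriction.tensor]
  cases h : χ.weave L K with
  | none =>
    have : ¬ (χ.compl H = K ∧ χ H = L) := by
      rintro ⟨rfl, rfl⟩
      rw [χ.weave_self] at h
      cases h
    simp only [Option.elim_none, lp.coeFn_zero, Pi.zero_apply]
    by_cases h₁ : χ.compl H = K <;> simp_all
  | some G =>
    obtain ⟨rfl, rfl⟩ := Restriction.weave_eq_some h
    simp only [Option.elim_some, ket_apply]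
    by_cases hHG : H = G
    · simp [hHG]
    · have : ¬ (χ.compl H = χ.compl G ∧ χ H = χ G) := by
        rintro ⟨h₁, h₂⟩
        apply hHG
        ext1
        rw [χ.carrier_eq_union, h₁, h₂, ← χ.carrier_eq_union]
      by_cases h₁ : χ.compl H = χ.compl G <;> simp_all

theorem contract_apply_eq_zero {χ : Restriction S V} {K L : SysGraph S V}
    (h : χ.tensor L K = 0) (ψ : GraphSpace S V) : χ.contract K ψ L = 0 := by
  rw [← inner_ket_left, ← ContinuousLinearMap.adjoint_inner_left, adjoint_contract_ket, h,
    inner_zero_left]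

/-- A local isometry sends `|G_χ⟩` to a combination of graphs that fit together with `G \ G_χ`. -/
theorem IsLocal.consistent_of_isometry {χ : Restriction S V} {A : Op S V} (h : IsLocal χ A)
    (hA : ∀ ψ, ‖A ψ‖ = ‖ψ‖) (G H : SysGraph S V) (hne : entry A H (χ G) ≠ 0) :
    χ.tensor H (χ.compl G) ≠ 0 := by
  intro h0
  set T := χ.contract (χ.compl G) with hT
  set φ := A (ket (χ G)) with hφ
  -- `T†` preserves the norm of `φ`, so `φ` lies in the range of the projection `T T†`.
  have h₁ : ‖T.adjoint φ‖ = 1 := by rw [hT, hφ, h.apply_ket, hA, norm_ket]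
  have h₂ : ‖φ‖ = 1 := by rw [hφ, hA, norm_ket]
  have h₃ : ‖T (T.adjoint φ)‖ ≤ 1 := h₁ ▸ contract_norm_le _ _ _
  have h₄ : φ - T (T.adjoint φ) = 0 := by
    have e := norm_sub_sq (𝕜 := ℂ) φ (T (T.adjoint φ))
    rw [← ContinuousLinearMap.adjoint_inner_left, inner_self_eq_norm_sq, h₁, h₂] at e
    have : ‖φ - T (T.adjoint φ)‖ ^ 2 ≤ 0 := by
      rw [e]; nlinarith [norm_nonneg (T (T.adjoint φ))]
    exact norm_eq_zero.1 (pow_eq_zero_iff two_ne_zero |>.1 (le_antisymm this (sq_nonneg _)))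
  apply hne
  rw [entry_eq_apply, ← hφ, sub_eq_zero.1 h₄]
  exact contract_apply_eq_zero h0 _

theorem norm_apply_of_mem_unitary {E : Type*} [NormedAddCommGroup E] [InnerProductSpace ℂ E]
    [CompleteSpace E] {A : E →L[ℂ] E} (hA : A ∈ unitary (E →L[ℂ] E)) (ψ : E) : ‖A ψ‖ = ‖ψ‖ :=
  (Unitary.linearIsometryEquiv ⟨A, hA⟩).norm_map ψ

/-- A local unitary is automatically strictly local. -/
theorem IsLocal.strict_of_unitary {χ : Restriction S V} {A : Op S V} (h : IsLocal χ A)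
    (hA : A ∈ unitary (Op S V)) : IsStrictlyLocal χ A :=
  ⟨h, fun G H => ⟨h.consistent_of_isometry (norm_apply_of_mem_unitary hA) G H,
    h.adjoint.consistent_of_isometry (norm_apply_of_mem_unitary (Unitary.star_mem hA)) G H⟩⟩

end Contraction

/-! ### Traceouts and the Heisenberg picture of causality -/

section Trace

variable {S V : Type*}

theorem adjoint_contract_contract_ket (χ : Restriction S V) (K G : SysGraph S V) :
    (χ.contract K).adjoint (χ.contract K (ket G)) =
      (⟪ket K, ket (χ.compl G)⟫ : ℂ) • ket G := by
  classical
  rw [Restriction.contract_ket, map_smul, inner_ket_ket]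
  by_cases h : K = χ.compl G
  · subst h
    have := (isLocal_one χ).apply_ket G
    simp only [one_apply_eq_self] at this
    rw [this]
  · simp [h]

/-- A local operator commutes with the projections `T_K† T_K`, in the form
`T_K† A T_K = A T_K† T_K`. -/
theorem IsLocal.adjoint_contract_comp {χ : Restriction S V} {A : Op S V} (h : IsLocal χ A)
    (K : SysGraph S V) (ψ : GraphSpace S V) :
    (χ.contract K).adjoint (A (χ.contract K ψ)) =
      A ((χ.contract K).adjoint (χ.contract K ψ)) := by
  classical
  have : (χ.contract K).adjoint ∘L A ∘L χ.contract K =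
      A ∘L (χ.contract K).adjoint ∘L χ.contract K := by
    apply ext_on_ket
    intro G
    simp only [ContinuousLinearMap.comp_apply]
    rw [adjoint_contract_contract_ket, Restriction.contract_ket]
    simp only [map_smul, inner_ket_ket]
    by_cases hK : K = χ.compl G
    · subst hK
      rw [h.apply_ket]
    · simp [hK]
  exact congrArg (fun B : Op S V => B ψ) this

/-- The projections `T_K† T_K` onto the spans of the `|G⟩` with `G \ G_χ = K` sum to the
identity. -/
theorem hasSum_adjoint_contract_contract (χ : Restriction S V) (ψ : GraphSpace S V) :
    HasSum (fun K => (χ.contract K).adjoint (χ.contract K ψ)) ψ := by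
  classical
  convert (hasSum_ket ψ).tsum_fiberwise χ.compl using 2 with K
  have h := (hasSum_ket ψ).mapL ((χ.contract K).adjoint ∘L χ.contract K)
  symm
  apply HasSum.tsum_eq
  rw [← Function.comp_def (fun G => ψ G • ket G), hasSum_subtype_iff_indicator]
  refine h.congr_fun ?_
  intro G
  simp only [map_smul, ContinuousLinearMap.comp_apply, adjoint_contract_contract_ket,
    inner_ket_ket, Set.indicator_apply, Set.mem_preimage, Set.mem_singleton_iff]
  by_cases hK : χ.compl G = K
  · simp [hK]
  · simp [hK, Ne.symm hK]

/-- The expectation value of a local operator is the sum of those of its contractions. -/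
theorem IsLocal.hasSum_inner_contract {χ : Restriction S V} {A : Op S V} (h : IsLocal χ A)
    (φ ψ : GraphSpace S V) :
    HasSum (fun K => (⟪χ.contract K φ, A (χ.contract K ψ)⟫ : ℂ)) ⟪φ, A ψ⟫ := by
  have := ((hasSum_adjoint_contract_contract χ ψ).mapL A).mapL (innerSL ℂ φ)
  simpa only [innerSL_apply_apply, ← h.adjoint_contract_comp,
    ContinuousLinearMap.adjoint_inner_right] using this

/-- The series defining the traceout of a rank-one operator converges absolutely. -/
theorem summable_norm_contract (χ : Restriction S V) (φ ψ : GraphSpace S V) :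
    Summable fun K => ‖χ.contract K φ‖ * ‖χ.contract K ψ‖ := by
  have key : ∀ θ : GraphSpace S V, Summable fun K => ‖χ.contract K θ‖ ^ 2 := by
    intro θ
    have h := ((isLocal_one χ).hasSum_inner_contract θ θ).mapL Complex.reCLM
    refine h.summable.congr fun K => ?_
    simpa using (inner_self_eq_norm_sq (𝕜 := ℂ) (χ.contract K θ))
  refine Summable.of_nonneg_of_le (fun K => by positivity) (fun K => ?_) ((key φ).add (key ψ))
  nlinarith [sq_nonneg (‖χ.contract K φ‖ - ‖χ.contract K ψ‖), sq_nonneg (‖χ.contract K φ‖),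
    sq_nonneg (‖χ.contract K ψ‖)]

/-- The matrix entries of the traceout of `|ψ⟩⟨φ|`. -/
theorem hasSum_entry_traceOut (χ : Restriction S V) (φ ψ : GraphSpace S V)
    (L M : SysGraph S V) :
    HasSum (fun K => χ.contract K ψ L * starRingEnd ℂ (χ.contract K φ M))
      (entry (χ.traceOut (InnerProductSpace.rankOne ℂ ψ φ)) L M) := by
  have e : ∀ K, χ.contract K ∘L InnerProductSpace.rankOne ℂ ψ φ ∘L (χ.contract K).adjoint =
      InnerProductSpace.rankOne ℂ (χ.contract K ψ) (χ.contract K φ) := by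
    intro K
    ext1 θ
    simp [InnerProductSpace.rankOne_apply, ContinuousLinearMap.adjoint_inner_right]
  have hs : Summable fun K =>
      InnerProductSpace.rankOne ℂ (χ.contract K ψ) (χ.contract K φ) := by
    apply Summable.of_norm
    simpa only [InnerProductSpace.norm_rankOne] using summable_norm_contract χ ψ φ
  have h := (hs.hasSum.mapL (ContinuousLinearMap.apply ℂ _ (ket M))).mapL (innerSL ℂ (ket L))
  unfold Restriction.traceOut
  simp_rw [e]
  refine h.congr_fun fun K => ?_
  simp only [ContinuousLinearMap.apply_apply, InnerProductSpace.rankOne_apply,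
    innerSL_apply_apply, inner_smul_right, inner_ket_left]
  rw [← inner_conj_symm, inner_ket_left, mul_comm]

theorem inner_sum_sum_ket (A : Op S V) (F : Finset (SysGraph S V)) (x y : GraphSpace S V) :
    (⟪∑ M ∈ F, x M • ket M, A (∑ L ∈ F, y L • ket L)⟫ : ℂ) =
      ∑ M ∈ F, ∑ L ∈ F, entry A M L * (y L * starRingEnd ℂ (x M)) := by
  rw [sum_inner]
  simp only [map_sum, map_smul, inner_sum, inner_smul_left, inner_smul_right, entry]
  refine Finset.sum_congr rfl fun M _ => Finset.sum_congr rfl fun L _ => ?_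
  ring

theorem norm_sum_ket_le (F : Finset (SysGraph S V)) (x : GraphSpace S V) :
    ‖∑ M ∈ F, x M • ket M‖ ≤ ‖x‖ := by
  classical
  have h : ∑ M ∈ F, x M • ket M = ∑ M ∈ F, lp.single 2 M (x M) := by
    refine Finset.sum_congr rfl fun M _ => ?_
    ext H
    simp [ket, lp.single_apply, Pi.single_apply]
  have h₂ := lp.norm_sum_single (E := fun _ : SysGraph S V => ℂ) (p := 2) (by norm_num) (⇑x) F
  have h₃ := lp.sum_rpow_le_norm_rpow (E := fun _ : SysGraph S V => ℂ) (p := 2) (by norm_num) x F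
  rw [← h₂, ← h] at h₃
  exact (Real.rpow_le_rpow_iff (norm_nonneg _) (norm_nonneg _) (by norm_num)).1 h₃

/-- For a `χ`-local operator `A`, the expectation `Tr(A |ψ⟩⟨φ|) = ⟨φ|A|ψ⟩` is recovered from the
traceout of `|ψ⟩⟨φ|`: it is the limit of the traces of `A` against the finite corners of it. -/
theorem IsLocal.tendsto_trace {χ : Restriction S V} {A : Op S V} (h : IsLocal χ A)
    (φ ψ : GraphSpace S V) :
    Tendsto (fun F : Finset (SysGraph S V) => ∑ M ∈ F, ∑ L ∈ F,
      entry A M L * entry (χ.traceOut (InnerProductSpace.rankOne ℂ ψ φ)) L M)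
      atTop (𝓝 (⟪φ, A ψ⟫ : ℂ)) := by
  have e : ∀ F : Finset (SysGraph S V), ∑ M ∈ F, ∑ L ∈ F,
      entry A M L * entry (χ.traceOut (InnerProductSpace.rankOne ℂ ψ φ)) L M =
      ∑' K, (⟪∑ M ∈ F, χ.contract K φ M • ket M, A (∑ L ∈ F, χ.contract K ψ L • ket L)⟫ : ℂ) := by
    intro F
    simp_rw [inner_sum_sum_ket]
    symm
    apply HasSum.tsum_eq
    exact hasSum_sum fun M _ => hasSum_sum fun L _ =>
      (hasSum_entry_traceOut χ φ ψ L M).mul_left _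
  simp_rw [e]
  rw [← (h.hasSum_inner_contract φ ψ).tsum_eq]
  refine tendsto_tsum_of_dominated_convergence
    (bound := fun K => ‖A‖ * (‖χ.contract K φ‖ * ‖χ.contract K ψ‖))
    ((summable_norm_contract χ φ ψ).mul_left _) ?_ ?_
  · intro K
    exact Filter.Tendsto.inner (hasSum_ket (χ.contract K φ))
      ((A.continuous.tendsto _).comp (hasSum_ket (χ.contract K ψ)))
  · refine Eventually.of_forall fun F K => ?_
    refine (norm_inner_le_norm _ _).trans ?_
    calc _ ≤ ‖χ.contract K φ‖ * (‖A‖ * ‖χ.contract K ψ‖) :=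
          mul_le_mul (norm_sum_ket_le _ _)
            ((A.le_opNorm _).trans (mul_le_mul_of_nonneg_left (norm_sum_ket_le _ _)
              (norm_nonneg _))) (norm_nonneg _) (norm_nonneg _)
      _ = _ := by ring

theorem isTraceClass_rankOne_ket (G H : SysGraph S V) :
    IsTraceClass (InnerProductSpace.rankOne ℂ (ket G) (ket H) : Op S V) := by
  classical
  -- `|ρ|` is the projection onto `|H⟩`.
  have habs : absOp (InnerProductSpace.rankOne ℂ (ket G) (ket H) : Op S V) =
      InnerProductSpace.rankOne ℂ (ket H) (ket H) := by
    unfold absOp CFC.abs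
    have hp : (0 : Op S V) ≤ InnerProductSpace.rankOne ℂ (ket H) (ket H) := by
      rw [ContinuousLinearMap.nonneg_iff_isPositive]
      exact InnerProductSpace.isPositive_rankOne_self _
    apply CFC.sqrt_unique
    · rw [ContinuousLinearMap.star_eq_adjoint, InnerProductSpace.adjoint_rankOne]
      simp only [ContinuousLinearMap.mul_def, InnerProductSpace.rankOne_comp_rankOne,
        inner_ket_ket, if_true]
    · exact hp
  unfold IsTraceClass
  rw [habs]
  refine summable_of_ne_finset_zero (s := {H}) fun M hM => ?_
  rw [Finset.mem_singleton] at hM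
  simp [entry, InnerProductSpace.rankOne_apply, inner_ket_ket, Ne.symm hM]

/-- In the Heisenberg picture, a `χζ`-causal operator sends `ζ`-local observables to `χ`-local
ones. -/
theorem IsCausal.isLocal_conj {χ ζ : Restriction S V} {U A : Op S V} (hU : IsCausal χ ζ U)
    (hA : IsLocal ζ A) : IsLocal χ (star U * A * U) := by
  intro G H
  have conj : ∀ x y : GraphSpace S V, U ∘L InnerProductSpace.rankOne ℂ x y ∘L U.adjoint =
      InnerProductSpace.rankOne ℂ (U x) (U y) := by
    intro x y
    ext1 θ
    simp [InnerProductSpace.rankOne_apply, ContinuousLinearMap.adjoint_inner_right]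
  -- Causality at `ρ = |G⟩⟨H|`, with the scalar in `ρ_{|χ}` absorbed into the first vector.
  have hc := hU _ (isTraceClass_rankOne_ket G H)
  rw [Restriction.traceOut_rankOne, ← smul_apply, ← map_smul, conj, conj] at hc
  have h₁ := hA.tendsto_trace (U (ket H)) (U (ket G))
  rw [hc] at h₁
  have h₂ := tendsto_nhds_unique h₁ (hA.tendsto_trace _ _)
  have e : ∀ x y : SysGraph S V, entry (star U * A * U) x y = ⟪U (ket x), A (U (ket y))⟫ := by
    intro x y
    simp [entry, ContinuousLinearMap.star_eq_adjoint, ContinuousLinearMap.adjoint_inner_right]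
  rw [e, e, h₂]
  simp only [map_smul, inner_smul_right]
  rw [mul_comm]

/-- Locality passes from a restriction to any restriction that comprehends it. -/
theorem IsLocal.of_comprehended {ζ χ : Restriction S V} (h : ζ.Comprehended χ) {A : Op S V}
    (hA : IsLocal ζ A) : IsLocal χ A := by
  intro G H
  rw [hA G H, hA (χ G) (χ H), h.1, h.1, h.2, mul_assoc]

end Trace

/-! ### Membership in restricted graphs -/

section Graphs

variable {S V : Type*}

theorem mem_atName {v : V} {G : SysGraph S V} {s : S × V} :
    s ∈ (Restriction.atName v G).carrier ↔ s ∈ G.carrier ∧ s.2 = v := Iff.rfl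

theorem mem_compl {χ : Restriction S V} {G : SysGraph S V} {s : S × V} :
    s ∈ (χ.compl G).carrier ↔ s ∈ G.carrier ∧ s ∉ (χ G).carrier := Iff.rfl

theorem mem_atName_compl {v : V} {G : SysGraph S V} {s : S × V} :
    s ∈ ((Restriction.atName v).compl G).carrier ↔ s ∈ G.carrier ∧ s.2 ≠ v := by
  rw [mem_compl, mem_atName]
  tauto

theorem mem_support {G : SysGraph S V} {v : V} :
    v ∈ G.support ↔ ∃ σ, (σ, v) ∈ G.carrier := by
  simp [SysGraph.support]

variable (S V) in
/-- The empty graph. -/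
def SysGraph.empty : SysGraph S V where
  carrier := ∅
  finite := Set.finite_empty
  wellNamed _ _ _ h := h.elim

theorem notMem_empty {s : S × V} : s ∉ (SysGraph.empty S V).carrier := Set.notMem_empty s

theorem eq_empty_of_support {G : SysGraph S V} (h : G.support = (SysGraph.empty S V).support) :
    G = SysGraph.empty S V := by
  ext ⟨σ, v⟩
  refine ⟨fun hs => ?_, fun hs => (notMem_empty hs).elim⟩
  obtain ⟨σ', h'⟩ := mem_support.1 (h ▸ mem_support.2 ⟨σ, hs⟩)
  exact (notMem_empty h').elim

/-! ### Splitting a graph by its ancilla bits -/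

/-- The part of `X` with ancilla bit `0`, as a graph over `S`. -/
def zeroPart (X : SysGraph (Fin 2 × S) V) : SysGraph S V := (mu S V X).forget

/-- The part of `X` with ancilla bit `1`, with the bits kept. -/
def onePart (X : SysGraph (Fin 2 × S) V) : SysGraph (Fin 2 × S) V := (mu S V).compl X

theorem mem_zeroPart {X : SysGraph (Fin 2 × S) V} {σ : S} {u : V} :
    (σ, u) ∈ (zeroPart X).carrier ↔ ((0, σ), u) ∈ X.carrier := by
  constructor
  · rintro ⟨⟨⟨b, σ'⟩, u'⟩, hs, h⟩
    simp only [Prod.mk.injEq] at h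
    obtain ⟨rfl, rfl⟩ := h
    have hb : b = 0 := (mem_mu.1 hs).2
    subst hb
    exact hs.1
  · intro h
    exact ⟨((0, σ), u), mem_mu.2 ⟨h, rfl⟩, rfl⟩

theorem mem_onePart {X : SysGraph (Fin 2 × S) V} {s : (Fin 2 × S) × V} :
    s ∈ (onePart X).carrier ↔ s ∈ X.carrier ∧ s.1.1 ≠ 0 := mem_mu_compl

theorem ext_parts {X Y : SysGraph (Fin 2 × S) V} (h₀ : zeroPart X = zeroPart Y)
    (h₁ : onePart X = onePart Y) : X = Y := by
  ext ⟨⟨b, σ⟩, u⟩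
  by_cases hb : b = 0
  · subst hb
    rw [← mem_zeroPart, ← mem_zeroPart, h₀]
  · have := congrArg (fun Z => ((b, σ), u) ∈ Z.carrier) h₁
    simpa [mem_onePart, hb] using this

theorem disjoint_parts (X : SysGraph (Fin 2 × S) V) :
    Disjoint (zeroPart X).support (onePart X).support := by
  rw [Set.disjoint_left]
  intro u h₀ h₁
  obtain ⟨σ, hσ⟩ := mem_support.1 h₀
  obtain ⟨⟨b, σ'⟩, hσ'⟩ := mem_support.1 h₁
  rw [mem_zeroPart] at hσ
  rw [mem_onePart] at hσ'
  exact hσ'.2 (congrArg Prod.fst (X.wellNamed _ _ _ hσ hσ'.1)).symm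

/-- A graph over `S` and a graph with all bits `1` fit together as soon as they share no name. -/
theorem exists_parts {M : SysGraph S V} {R : SysGraph (Fin 2 × S) V}
    (hd : Disjoint M.support R.support) (hR : onePart R = R) :
    ∃ X, zeroPart X = M ∧ onePart X = R := by
  have hR' : ∀ s ∈ R.carrier, s.1.1 ≠ 0 := fun s hs => by
    rw [← hR] at hs
    exact (mem_onePart.1 hs).2
  have h₀ : ∀ b σ u, ((b, σ), u) ∈ M.addZero.carrier ↔ b = 0 ∧ (σ, u) ∈ M.carrier := by
    intro b σ u
    constructor
    · rintro ⟨_, h, h'⟩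
      simp only [Prod.mk.injEq] at h'
      obtain ⟨⟨rfl, rfl⟩, rfl⟩ := h'
      exact ⟨rfl, h⟩
    · rintro ⟨rfl, h⟩
      exact ⟨_, h, rfl⟩
  have key : ∀ σ σ' v, (σ, v) ∈ M.addZero.carrier → (σ', v) ∉ R.carrier := by
    rintro ⟨b, σ⟩ σ' v h h'
    exact Set.disjoint_left.1 hd (mem_support.2 ⟨σ, ((h₀ _ _ _).1 h).2⟩) (mem_support.2 ⟨σ', h'⟩)
  refine ⟨⟨M.addZero.carrier ∪ R.carrier, M.addZero.finite.union R.finite, ?_⟩, ?_, ?_⟩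
  · rintro σ σ' v (h | h) (h' | h')
    · exact M.addZero.wellNamed _ _ _ h h'
    · exact (key _ _ _ h h').elim
    · exact (key _ _ _ h' h).elim
    · exact R.wellNamed _ _ _ h h'
  · ext ⟨σ, u⟩
    rw [mem_zeroPart]
    refine ⟨?_, fun h => Or.inl ((h₀ _ _ _).2 ⟨rfl, h⟩)⟩
    rintro (h | h)
    · exact ((h₀ _ _ _).1 h).2
    · exact (hR' _ h rfl).elim
  · ext ⟨⟨b, σ⟩, u⟩
    rw [mem_onePart]
    refine ⟨?_, fun h => ⟨Or.inr h, hR' _ h⟩⟩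
    rintro ⟨h | h, hb⟩
    · exact (hb ((h₀ _ _ _).1 h).1).elim
    · exact h

theorem onePart_onePart (X : SysGraph (Fin 2 × S) V) : onePart (onePart X) = onePart X := by
  ext s
  simp only [mem_onePart]
  tauto

theorem exists_parts_of_support {M : SysGraph S V} {X : SysGraph (Fin 2 × S) V}
    (h : M.support = (zeroPart X).support) :
    ∃ Y, zeroPart Y = M ∧ onePart Y = onePart X :=
  exists_parts (h ▸ disjoint_parts X) (onePart_onePart X)

theorem zeroPart_atName (v : V) (X : SysGraph (Fin 2 × S) V) :
    zeroPart (Restriction.atName v X) = Restriction.atName v (zeroPart X) := by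
  ext ⟨σ, u⟩
  simp only [mem_zeroPart, mem_atName]

theorem onePart_atName (v : V) (X : SysGraph (Fin 2 × S) V) :
    onePart (Restriction.atName v X) = Restriction.atName v (onePart X) := by
  ext s
  simp only [mem_onePart, mem_atName]
  tauto

theorem zeroPart_atName_compl (v : V) (X : SysGraph (Fin 2 × S) V) :
    zeroPart ((Restriction.atName v).compl X) = (Restriction.atName v).compl (zeroPart X) := by
  ext ⟨σ, u⟩
  simp only [mem_zeroPart, mem_atName_compl]

theorem onePart_atName_compl (v : V) (X : SysGraph (Fin 2 × S) V) :
    onePart ((Restriction.atName v).compl X) = (Restriction.atName v).compl (onePart X) := by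
  ext s
  simp only [mem_onePart, mem_atName_compl]
  tauto

theorem atName_atName (v : V) (G : SysGraph S V) :
    Restriction.atName v (Restriction.atName v G) = Restriction.atName v G := by
  ext s
  simp only [mem_atName]
  tauto

theorem atName_compl_atName (v : V) (G : SysGraph S V) :
    (Restriction.atName v).compl (Restriction.atName v G) = SysGraph.empty S V := by
  ext s
  simp only [mem_atName_compl, mem_atName, notMem_empty]
  tauto

theorem zeroPart_xi (χ : Restriction S V) (v : V) (X : SysGraph (Fin 2 × S) V) :
    zeroPart (xi χ v X) = χ (zeroPart X) := by
  ext ⟨σ, u⟩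
  rw [mem_zeroPart]
  constructor
  · rintro (⟨_, h, h'⟩ | h)
    · simp only [Prod.mk.injEq] at h'
      obtain ⟨⟨-, rfl⟩, rfl⟩ := h'
      exact h
    · exact ((mem_mu_compl.1 h.1).2 rfl).elim
  · intro h
    exact Or.inl ⟨_, h, rfl⟩

theorem onePart_xi (χ : Restriction S V) (v : V) (X : SysGraph (Fin 2 × S) V) :
    onePart (xi χ v X) = Restriction.atName v (onePart X) := by
  ext s
  rw [mem_onePart]
  constructor
  · rintro ⟨h | h, hs⟩
    · exact (hs (muThen_subset χ X h).2).elim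
    · exact h
  · intro h
    exact ⟨Or.inr h, (mem_mu_compl.1 h.1).2⟩

theorem zeroPart_xi_compl (χ : Restriction S V) (v : V) (X : SysGraph (Fin 2 × S) V) :
    zeroPart ((xi χ v).compl X) = χ.compl (zeroPart X) := by
  ext ⟨σ, u⟩
  rw [mem_zeroPart, mem_compl, mem_compl, ← mem_zeroPart, ← mem_zeroPart, zeroPart_xi]

theorem onePart_xi_compl (χ : Restriction S V) (v : V) (X : SysGraph (Fin 2 × S) V) :
    onePart ((xi χ v).compl X) = (Restriction.atName v).compl (onePart X) := by
  ext s
  have h := congrArg (fun Z => s ∈ Z.carrier) (onePart_xi χ v X)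
  simp only [mem_onePart, mem_atName, eq_iff_iff] at h
  simp only [mem_onePart, mem_compl, mem_atName]
  tauto

theorem zeroPart_addZero (G : SysGraph S V) : zeroPart G.addZero = G := by
  ext ⟨σ, u⟩
  rw [mem_zeroPart]
  constructor
  · rintro ⟨_, h, h'⟩
    simp only [Prod.mk.injEq] at h'
    obtain ⟨⟨-, rfl⟩, rfl⟩ := h'
    exact h
  · intro h
    exact ⟨_, h, rfl⟩

theorem onePart_addZero (G : SysGraph S V) : onePart G.addZero = SysGraph.empty (Fin 2 × S) V := by
  ext s
  simp only [mem_onePart, notMem_empty, iff_false]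
  rintro ⟨⟨_, _, rfl⟩, h⟩
  exact h rfl

end Graphs

/-! ### Toggling ancilla bits -/

section Toggle

variable {S V : Type*}

open Classical in
/-- Toggle the ancilla bits of the systems whose names lie in `s`. -/
def toggle (s : Set V) (X : SysGraph (Fin 2 × S) V) : SysGraph (Fin 2 × S) V where
  carrier := {x | ((if x.2 ∈ s then x.1.1 + 1 else x.1.1, x.1.2), x.2) ∈ X.carrier}
  finite := by
    refine X.finite.preimage (f := fun x : (Fin 2 × S) × V =>
      ((if x.2 ∈ s then x.1.1 + 1 else x.1.1, x.1.2), x.2)) (Function.Injective.injOn ?_)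
    rintro ⟨⟨b, σ⟩, u⟩ ⟨⟨b', σ'⟩, u'⟩ h
    simp only [Prod.mk.injEq] at h
    obtain ⟨⟨hb, rfl⟩, rfl⟩ := h
    split_ifs at hb <;> simp_all
  wellNamed := by
    rintro ⟨b, σ⟩ ⟨b', σ'⟩ u h h'
    have e := X.wellNamed _ _ _ h h'
    simp only [Prod.mk.injEq] at e ⊢
    obtain ⟨hb, rfl⟩ := e
    split_ifs at hb <;> simp_all

open Classical in
theorem mem_toggle {s : Set V} {X : SysGraph (Fin 2 × S) V} {b : Fin 2} {σ : S} {u : V} :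
    ((b, σ), u) ∈ (toggle s X).carrier ↔ ((if u ∈ s then b + 1 else b, σ), u) ∈ X.carrier := Iff.rfl

theorem fin_two_add_one_add_one (b : Fin 2) : b + 1 + 1 = b := by
  revert b; decide

theorem toggle_toggle (s : Set V) (X : SysGraph (Fin 2 × S) V) : toggle s (toggle s X) = X := by
  ext ⟨⟨b, σ⟩, u⟩
  rw [mem_toggle, mem_toggle]
  split_ifs <;> simp [fin_two_add_one_add_one]

theorem toggle_injective (s : Set V) : Function.Injective (toggle (S := S) s) :=
  Function.Involutive.injective (toggle_toggle s)

theorem toggle_singleton_toggle {v : V} {s : Set V} (h : v ∉ s) (X : SysGraph (Fin 2 × S) V) :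
    toggle {v} (toggle s X) = toggle (insert v s) X := by
  ext ⟨⟨b, σ⟩, u⟩
  rw [mem_toggle, mem_toggle, mem_toggle]
  by_cases huv : u = v
  · subst huv
    simp [h]
  · by_cases hu : u ∈ s <;> simp [huv, hu]

theorem toggle_comm (s t : Set V) (X : SysGraph (Fin 2 × S) V) :
    toggle s (toggle t X) = toggle t (toggle s X) := by
  ext ⟨⟨b, σ⟩, u⟩
  rw [mem_toggle, mem_toggle, mem_toggle, mem_toggle]
  split_ifs <;> rfl

theorem toggle_empty (X : SysGraph (Fin 2 × S) V) : toggle ∅ X = X := by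
  ext ⟨⟨b, σ⟩, u⟩
  simp [mem_toggle]

theorem toggle_eq_toggle_univ {s : Set V} {X : SysGraph (Fin 2 × S) V} (h : X.support ⊆ s) :
    toggle s X = toggle Set.univ X := by
  ext ⟨⟨b, σ⟩, u⟩
  rw [mem_toggle, mem_toggle]
  by_cases hu : u ∈ s
  · simp [hu]
  · have : ∀ σ', (σ', u) ∉ X.carrier := fun σ' h' => hu (h (mem_support.2 ⟨σ', h'⟩))
    simp [this]

theorem zeroPart_toggle_univ_addZero (G : SysGraph S V) :
    zeroPart (toggle Set.univ G.addZero) = SysGraph.empty S V := by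
  ext ⟨σ, u⟩
  rw [mem_zeroPart, mem_toggle]
  simp only [notMem_empty, iff_false]
  rintro ⟨_, _, h⟩
  simp at h

/-- The toggle at `v` acts on the system named `v` and fixes the others. -/
theorem eq_toggle_iff {v : V} {X Y : SysGraph (Fin 2 × S) V} :
    X = toggle {v} Y ↔ Restriction.atName v X = toggle {v} (Restriction.atName v Y) ∧
      (Restriction.atName v).compl X = (Restriction.atName v).compl Y := by
  constructor
  · rintro rfl
    constructor
    · ext ⟨⟨b, σ⟩, u⟩
      simp only [mem_atName, mem_toggle]
    · ext ⟨⟨b, σ⟩, u⟩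
      simp only [mem_atName_compl, mem_toggle]
      by_cases hu : u = v <;> simp [hu]
  · rintro ⟨h₁, h₂⟩
    ext ⟨⟨b, σ⟩, u⟩
    have h₁ := congrArg (fun Z => ((b, σ), u) ∈ Z.carrier) h₁
    have h₂ := congrArg (fun Z => ((b, σ), u) ∈ Z.carrier) h₂
    simp only [mem_atName, mem_toggle, mem_atName_compl, eq_iff_iff] at h₁ h₂
    rw [mem_toggle]
    by_cases hu : u = v
    · subst hu
      simpa using h₁
    · simpa [hu] using h₂

/-- The operator `|X⟩ ↦ |toggle s X⟩`. -/
def toggleOp (s : Set V) : Op (Fin 2 × S) V :=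
  pull (fun X => some (toggle s X)) fun _ _ _ h h' =>
    toggle_injective s (Option.some.inj (h.trans h'.symm))

theorem toggleOp_ket (s : Set V) (X : SysGraph (Fin 2 × S) V) :
    toggleOp s (ket X) = ket (toggle s X) := by
  classical
  ext Y
  simp only [toggleOp, pull_apply, Option.elim_some, ket_apply]
  congr 1
  exact propext ⟨fun h => by rw [← h, toggle_toggle], fun h => by rw [h, toggle_toggle]⟩

theorem toggleOp_mul_self (s : Set V) : toggleOp (S := S) s * toggleOp s = 1 := by
  apply ext_on_ket
  intro X
  rw [mul_apply_eq_comp, toggleOp_ket, toggleOp_ket, toggle_toggle, one_apply_eq_self]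

open Classical in
theorem entry_toggleOp (s : Set V) (X Y : SysGraph (Fin 2 × S) V) :
    entry (toggleOp s) X Y = if X = toggle s Y then 1 else 0 := by
  rw [entry, toggleOp_ket, inner_ket_ket]

theorem star_toggleOp (s : Set V) : star (toggleOp (S := S) s) = toggleOp s := by
  classical
  apply ext_on_ket
  intro X
  ext Y
  rw [← entry_eq_apply, ← entry_eq_apply, ContinuousLinearMap.star_eq_adjoint, entry_adjoint,
    entry_toggleOp, entry_toggleOp, apply_ite (starRingEnd ℂ), map_one, map_zero]
  congr 1
  exact propext ⟨fun h => by rw [h, toggle_toggle], fun h => by rw [h, toggle_toggle]⟩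

theorem toggleOp_mem_unitary (s : Set V) : toggleOp (S := S) s ∈ unitary (Op (Fin 2 × S) V) := by
  rw [Unitary.mem_iff, star_toggleOp, toggleOp_mul_self, and_self]

theorem toggleOp_commute (s t : Set V) : Commute (toggleOp (S := S) s) (toggleOp t) := by
  apply ext_on_ket
  intro X
  simp only [mul_apply_eq_comp, toggleOp_ket, toggle_comm s t]

theorem isLocal_toggleOp (v : V) : IsLocal (Restriction.atName v) (toggleOp (S := S) {v}) := by
  classical
  intro X Y
  rw [entry_toggleOp, entry_toggleOp, inner_ket_ket]
  simp only [eq_toggle_iff (X := Y), ite_and]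
  split_ifs <;> simp

theorem IsLocal.smul {χ : Restriction S V} {A : Op S V} (h : IsLocal χ A) (c : ℂ) :
    IsLocal χ (c • A) := by
  intro G H
  have e : ∀ x y, entry (c • A) x y = c * entry A x y := fun x y => by
    rw [entry, smul_apply, inner_smul_right, entry]
  rw [e, e, h G H, mul_assoc]

/-- Pointwise convergence of contractions need only be checked on the basis vectors. -/
theorem tendsto_of_tendsto_ket {ι : Type*} {l : Filter ι} {A : ι → Op S V} {B : Op S V}
    (hA : ∀ i ψ, ‖A i ψ‖ ≤ ‖ψ‖)
    (h : ∀ G, Tendsto (fun i => A i (ket G)) l (𝓝 (B (ket G)))) (ψ : GraphSpace S V) :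
    Tendsto (fun i => A i ψ) l (𝓝 (B ψ)) := by
  have hc : IsClosed {ψ | Tendsto (fun i => A i ψ) l (𝓝 (B ψ))} := by
    refine Equicontinuous.isClosed_setOfPred_tendsto (F := fun i ψ => A i ψ) ?_ B.continuous
    refine (LipschitzWith.uniformEquicontinuous _ 1 fun i => ?_).equicontinuous
    refine LipschitzWith.of_dist_le_mul fun x y => ?_
    rw [dist_eq_norm, dist_eq_norm, ← map_sub, NNReal.coe_one, one_mul]
    exact hA i _
  refine hc.mem_of_tendsto (hasSum_ket ψ) (Eventually.of_forall fun F => ?_)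
  simp only [Set.mem_ofPred_eq, map_sum, map_smul]
  exact tendsto_finsetSum _ fun G _ => (h G).const_smul _

theorem tendsto_toggleOp (ψ : GraphSpace (Fin 2 × S) V) :
    Tendsto (fun F : Finset V => toggleOp (S := S) (F : Set V) ψ) atTop
      (𝓝 (toggleOp Set.univ ψ)) := by
  classical
  refine tendsto_of_tendsto_ket
    (fun F ψ => (norm_apply_of_mem_unitary (toggleOp_mem_unitary _) ψ).le) (fun X => ?_) ψ
  have hfin : X.support.Finite := X.finite.image _
  refine tendsto_const_nhds.congr' ?_
  filter_upwards [eventually_ge_atTop hfin.toFinset] with F hF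
  rw [toggleOp_ket, toggleOp_ket,
    toggle_eq_toggle_univ (s := F) fun u hu => hF (hfin.mem_toFinset.2 hu)]

theorem noncommProd_smul_toggleOp (c : V → ℂ) (F : Finset V)
    (comm : (F : Set V).Pairwise
      (Function.onFun Commute fun v => c v • toggleOp (S := S) {v})) :
    F.noncommProd (fun v => c v • toggleOp (S := S) {v}) comm =
      (∏ v ∈ F, c v) • toggleOp (F : Set V) := by
  classical
  induction F using Finset.induction_on with
  | empty =>
    rw [Finset.noncommProd_empty, Finset.prod_empty, one_smul]
    apply ext_on_ket
    intro X
    rw [Finset.coe_empty, toggleOp_ket, toggle_empty, one_apply_eq_self]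
  | insert v F hv ih =>
    rw [Finset.noncommProd_insert_of_notMem _ _ _ _ hv, ih, Finset.prod_insert hv,
      smul_mul_smul_comm]
    congr 1
    apply ext_on_ket
    intro X
    rw [mul_apply_eq_comp, toggleOp_ket, toggleOp_ket, toggleOp_ket, toggle_singleton_toggle,
      Finset.coe_insert]
    simpa using hv

theorem noncommProd_conj {ι R : Type*} [Ring R] [StarRing R] {W : R} (hW : W ∈ unitary R)
    (A : ι → R) (F : Finset ι) (hA : (F : Set ι).Pairwise (Function.onFun Commute A))
    (hK : (F : Set ι).Pairwise (Function.onFun Commute fun v => star W * A v * W)) :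
    F.noncommProd (fun v => star W * A v * W) hK = star W * F.noncommProd A hA * W := by
  classical
  induction F using Finset.induction_on with
  | empty => simp [Unitary.star_mul_self_of_mem hW]
  | insert v F hv ih =>
    rw [Finset.noncommProd_insert_of_notMem _ _ _ _ hv,
      Finset.noncommProd_insert_of_notMem _ _ _ _ hv,
      ih (hA.mono (by simp))]
    simp only [mul_assoc]
    rw [← mul_assoc W (star W), Unitary.mul_star_self_of_mem hW, one_mul]

end Toggle

/-! ### Extending a name-preserving unitary to the ancilla bits -/

section Attach

variable {S V : Type*}

open Classical in
/-- The operator `|M⟩ ↦ |0.M ∪ R⟩` that adjoins a graph `R` all of whose ancilla bits are `1`; it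
vanishes on the `|M⟩` that share a name with `R`. -/
def attach (R : SysGraph (Fin 2 × S) V) : GraphSpace S V →L[ℂ] GraphSpace (Fin 2 × S) V :=
  pull (fun X => if onePart X = R then some (zeroPart X) else none) fun X Y M hX hY => by
    split_ifs at hX hY with h h'
    exact ext_parts ((Option.some.inj hX).trans (Option.some.inj hY).symm) (h.trans h'.symm)

open Classical in
theorem attach_apply (R : SysGraph (Fin 2 × S) V) (ψ : GraphSpace S V)
    (X : SysGraph (Fin 2 × S) V) :
    attach R ψ X = if onePart X = R then ψ (zeroPart X) else 0 := by
  rw [attach, pull_apply]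
  split_ifs <;> rfl

theorem attach_ket (X : SysGraph (Fin 2 × S) V) :
    attach (onePart X) (ket (zeroPart X)) = ket X := by
  classical
  ext Y
  rw [attach_apply, ket_apply, ket_apply, ← ite_and]
  congr 1
  exact propext ⟨fun h => ext_parts h.2 h.1, fun h => by rw [h]; exact ⟨rfl, rfl⟩⟩

theorem attach_ket_eq_zero {R : SysGraph (Fin 2 × S) V} {M : SysGraph S V}
    (h : ¬ ∃ X, zeroPart X = M ∧ onePart X = R) : attach R (ket M) = 0 := by
  classical
  ext Y
  rw [attach_apply, ket_apply, ← ite_and, if_neg fun h' => h ⟨Y, h'.2, h'.1⟩]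
  rfl

/-- Sandwiches of `T` between attached vectors reduce to entries between attached basis vectors. -/
theorem inner_attach {T : Op (Fin 2 × S) V} {B : Op S V} {R R' : SysGraph (Fin 2 × S) V}
    {x y : GraphSpace S V}
    (h : ∀ M N, x M ≠ 0 → y N ≠ 0 →
      (⟪attach R (ket M), T (attach R' (ket N))⟫ : ℂ) = entry B M N) :
    (⟪attach R x, T (attach R' y)⟫ : ℂ) = ⟪x, B y⟫ := by
  have := inner_congr_of_entry (A := (attach R).adjoint ∘L T ∘L attach R') (B := B) (x := x)
    (y := y) fun M N hM hN => by
      rw [← h M N hM hN, entry]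
      simp [ContinuousLinearMap.adjoint_inner_right]
  rw [← this]
  simp [ContinuousLinearMap.adjoint_inner_right]

theorem IsNamePreserving.support_eq {U : Op S V} (h : IsNamePreserving U) {G M : SysGraph S V}
    (hM : U (ket G) M ≠ 0) : M.support = G.support := by
  by_contra hne
  exact hM (by rw [← entry_eq_apply]; exact h G M (Ne.symm hne))

/-- The prescribed images of the basis vectors under the extension of `U` are orthonormal. -/
theorem inner_attach_unitary {U : Op S V} (hU : U ∈ unitary (Op S V)) (hnp : IsNamePreserving U)
    (X Y : SysGraph (Fin 2 × S) V) :
    (⟪attach (onePart X) (U (ket (zeroPart X))), attach (onePart Y) (U (ket (zeroPart Y)))⟫ : ℂ) =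
      ⟪ket X, ket Y⟫ := by
  classical
  have h := inner_attach (T := 1) (B := if onePart X = onePart Y then 1 else 0)
    (R := onePart X) (R' := onePart Y) (x := U (ket (zeroPart X))) (y := U (ket (zeroPart Y)))
    fun M N hM hN => by
      obtain ⟨X', rfl, hX'⟩ := exists_parts_of_support (hnp.support_eq hM)
      obtain ⟨Y', rfl, hY'⟩ := exists_parts_of_support (hnp.support_eq hN)
      rw [← hX', ← hY', attach_ket, attach_ket, one_apply_eq_self, inner_ket_ket, entry]
      by_cases h₁ : onePart X' = onePart Y'
      · rw [if_pos h₁, one_apply_eq_self, inner_ket_ket]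
        congr 1
        exact propext ⟨fun e => by rw [e], fun e => ext_parts e h₁⟩
      · rw [if_neg h₁, if_neg fun e => h₁ (by rw [e]), zero_apply, inner_zero_right]
  rw [one_apply_eq_self] at h
  rw [h, inner_ket_ket]
  by_cases h₁ : onePart X = onePart Y
  · rw [if_pos h₁, one_apply_eq_self]
    refine ((Unitary.linearIsometryEquiv ⟨U, hU⟩).inner_map_map _ _).trans ?_
    rw [inner_ket_ket]
    congr 1
    exact propext ⟨fun e => ext_parts e h₁, fun e => by rw [e]⟩
  · rw [if_neg h₁, if_neg fun e => h₁ (by rw [e]), zero_apply, inner_zero_right]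

/-- The prescribed images of the basis vectors under the extension of `U` span a dense subspace. -/
theorem eq_zero_of_inner_attach {U : Op S V} (hU : U ∈ unitary (Op S V))
    (hnp : IsNamePreserving U) {φ : GraphSpace (Fin 2 × S) V}
    (h : ∀ X, (⟪attach (onePart X) (U (ket (zeroPart X))), φ⟫ : ℂ) = 0) : φ = 0 := by
  classical
  have key : ∀ X : SysGraph (Fin 2 × S) V, (attach (onePart X)).adjoint φ = 0 := by
    intro X
    have h₁ : star U ((attach (onePart X)).adjoint φ) = 0 := by
      ext G
      rw [← inner_ket_left, ContinuousLinearMap.star_eq_adjoint,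
        ContinuousLinearMap.adjoint_inner_right, ContinuousLinearMap.adjoint_inner_right]
      by_cases hG : ∃ Y, zeroPart Y = G ∧ onePart Y = onePart X
      · obtain ⟨Y, rfl, hY⟩ := hG
        rw [← hY]
        exact h Y
      · -- `G` shares a name with `onePart X`, and so do all graphs occurring in `U |G⟩`.
        have : attach (onePart X) (U (ket G)) = 0 := by
          ext Z
          rw [attach_apply]
          split_ifs with hZ
          · by_contra hne
            obtain ⟨Y, hY⟩ := exists_parts_of_support (hnp.support_eq hne).symm
            exact hG ⟨Y, hY.1, hY.2.trans hZ⟩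
          · rfl
        rw [this, inner_zero_left]
        rfl
    have h₂ := congrArg U h₁
    rwa [← mul_apply_eq_comp, Unitary.mul_star_self_of_mem hU, one_apply_eq_self,
      map_zero] at h₂
  ext X
  rw [← inner_ket_left, ← attach_ket X, ← ContinuousLinearMap.adjoint_inner_right, key,
    inner_zero_right]
  rfl

/-- A name-preserving unitary extends to a unitary on the space with ancilla bits, which acts on
the part with bit `0` and leaves the part with bit `1` alone. -/
theorem exists_unitary_extension {U : Op S V} (hU : U ∈ unitary (Op S V))
    (hnp : IsNamePreserving U) :
    ∃ W ∈ unitary (Op (Fin 2 × S) V),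
      ∀ X, W (ket X) = attach (onePart X) (U (ket (zeroPart X))) := by
  classical
  -- The prescribed images of the basis vectors form a Hilbert basis.
  have ho : Orthonormal ℂ fun X : SysGraph (Fin 2 × S) V =>
      attach (onePart X) (U (ket (zeroPart X))) := by
    rw [orthonormal_iff_ite]
    intro X Y
    rw [inner_attach_unitary hU hnp, inner_ket_ket]
  have hsp : (Submodule.span ℂ (Set.range fun X : SysGraph (Fin 2 × S) V =>
      attach (onePart X) (U (ket (zeroPart X)))))ᗮ = ⊥ := by
    rw [Submodule.eq_bot_iff]
    intro φ hφ
    exact eq_zero_of_inner_attach hU hnp fun X => hφ _ (Submodule.subset_span ⟨X, rfl⟩)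
  let b := HilbertBasis.mkOfOrthogonalEqBot ho hsp
  refine ⟨_, (Unitary.linearIsometryEquiv.symm b.repr.symm).2, fun X => ?_⟩
  have h := b.repr_symm_single X
  rw [HilbertBasis.coe_mkOfOrthogonalEqBot] at h
  rw [← h]
  rfl

/-! ### Locality of the conjugated toggles -/

/-- The effect of toggling the bit at `v` on the part with bit `0`, when the parts with bit `1`
after and before are `a` and `b`. -/
def toggleBlock (v : V) (a b : SysGraph (Fin 2 × S) V) : Op S V :=
  (attach a).adjoint ∘L toggleOp {v} ∘L attach b

theorem entry_toggleBlock (v : V) (a b : SysGraph (Fin 2 × S) V) (M N : SysGraph S V) :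
    entry (toggleBlock v a b) M N = ⟪attach a (ket M), toggleOp {v} (attach b (ket N))⟫ := by
  simp [entry, toggleBlock, ContinuousLinearMap.adjoint_inner_right]

/-- If `M` does not fit together with the system of `X` with bit `1` at `v`, then neither does the
restriction of `M` to `v`. -/
theorem attach_ket_atName_eq_zero {v : V} {X : SysGraph (Fin 2 × S) V} {M : SysGraph S V}
    (h : ¬ ∃ Z, zeroPart Z = M ∧ onePart Z = Restriction.atName v (onePart X)) :
    attach (Restriction.atName v (onePart X)) (ket (Restriction.atName v M)) = 0 := by
  apply attach_ket_eq_zero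
  rintro ⟨Z, hZ₀, hZ₁⟩
  apply h
  refine exists_parts (Set.disjoint_left.2 fun u hM hR => ?_) ?_
  · obtain ⟨σ, hσ⟩ := mem_support.1 hM
    obtain ⟨σ', hσ'⟩ := mem_support.1 hR
    have hu : u = v := hσ'.2
    refine Set.disjoint_left.1 (disjoint_parts Z) (?_ : u ∈ _) ?_
    · rw [hZ₀]
      exact mem_support.2 ⟨σ, hσ, hu⟩
    · rwa [hZ₁]
  · rw [onePart_atName, onePart_onePart]

/-- The toggle at `v`, seen from the part with bit `0` between fixed systems with bit `1` at `v`, is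
`ζ_v`-local. -/
theorem isLocal_toggleBlock (v : V) (X Y : SysGraph (Fin 2 × S) V) :
    IsLocal (Restriction.atName v) (toggleBlock v (Restriction.atName v (onePart X))
      (Restriction.atName v (onePart Y))) := by
  classical
  intro N M
  rw [entry_toggleBlock, entry_toggleBlock]
  by_cases hM : ∃ Z, zeroPart Z = M ∧ onePart Z = Restriction.atName v (onePart X)
  swap
  · rw [attach_ket_eq_zero hM, attach_ket_atName_eq_zero hM, inner_zero_left, inner_zero_left,
      zero_mul]
  by_cases hN : ∃ Z, zeroPart Z = N ∧ onePart Z = Restriction.atName v (onePart Y)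
  swap
  · rw [attach_ket_eq_zero hN, attach_ket_atName_eq_zero hN, map_zero, inner_zero_right,
      inner_zero_right, zero_mul]
  obtain ⟨P, rfl, hP⟩ := hM
  obtain ⟨Q, rfl, hQ⟩ := hN
  have e : ∀ {Z Z' : SysGraph (Fin 2 × S) V}, onePart Z = Restriction.atName v (onePart Z') →
      attach (Restriction.atName v (onePart Z')) (ket (Restriction.atName v (zeroPart Z))) =
        ket (Restriction.atName v Z) := by
    intro Z Z' h
    rw [← attach_ket (Restriction.atName v Z), zeroPart_atName, onePart_atName, h, atName_atName]
  have hc : (Restriction.atName v).compl P = (Restriction.atName v).compl Q ↔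
      (Restriction.atName v).compl (zeroPart P) = (Restriction.atName v).compl (zeroPart Q) := by
    constructor
    · intro h
      rw [← zeroPart_atName_compl, h, zeroPart_atName_compl]
    · intro h
      apply ext_parts
      · rw [zeroPart_atName_compl, h, zeroPart_atName_compl]
      · rw [onePart_atName_compl, hP, onePart_atName_compl, hQ, atName_compl_atName,
          atName_compl_atName]
  have key := isLocal_toggleOp (S := S) v Q P
  rw [e hP, e hQ, ← hP, ← hQ, attach_ket, attach_ket]
  rw [inner_ket_ket] at key ⊢
  simp only [hc] at key
  exact key

open Classical in
/-- Splitting off the systems with bit `1` away from `v`, which the toggle at `v` leaves alone. -/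
theorem inner_attach_toggleOp {U : Op S V} (hnp : IsNamePreserving U) (v : V)
    (X Y : SysGraph (Fin 2 × S) V) :
    (⟪attach (onePart X) (U (ket (zeroPart X))),
        toggleOp {v} (attach (onePart Y) (U (ket (zeroPart Y))))⟫ : ℂ) =
      if (Restriction.atName v).compl (onePart X) = (Restriction.atName v).compl (onePart Y) then
        ⟪U (ket (zeroPart X)), toggleBlock v (Restriction.atName v (onePart X))
          (Restriction.atName v (onePart Y)) (U (ket (zeroPart Y)))⟫ else 0 := by
  have h := inner_attach (T := toggleOp {v})
    (B := if (Restriction.atName v).compl (onePart X) = (Restriction.atName v).compl (onePart Y)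
      then toggleBlock v (Restriction.atName v (onePart X)) (Restriction.atName v (onePart Y))
      else 0)
    (R := onePart X) (R' := onePart Y) (x := U (ket (zeroPart X))) (y := U (ket (zeroPart Y)))
    fun M N hM hN => by
      obtain ⟨P, rfl, hP⟩ := exists_parts_of_support (hnp.support_eq hM)
      obtain ⟨Q, rfl, hQ⟩ := exists_parts_of_support (hnp.support_eq hN)
      rw [← hP, ← hQ, attach_ket, attach_ket, toggleOp_ket, inner_ket_ket]
      -- `ρ` drops the systems with bit `1` away from `v`.
      let ρ : Restriction (Fin 2 × S) V := .pointwise fun s => s.1.1 = 0 ∨ s.2 = v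
      have hρ : ∀ (Z : SysGraph (Fin 2 × S) V) (s : (Fin 2 × S) × V),
          s ∈ (ρ Z).carrier ↔ s ∈ Z.carrier ∧ (s.1.1 = 0 ∨ s.2 = v) := fun _ _ => Iff.rfl
      have hz : ∀ Z, zeroPart (ρ Z) = zeroPart Z := by
        intro Z
        ext ⟨σ, u⟩
        simp [mem_zeroPart, hρ]
      have ho : ∀ Z, onePart (ρ Z) = Restriction.atName v (onePart Z) := by
        intro Z
        ext s
        simp only [mem_onePart, hρ, mem_atName]
        tauto
      have ha : ∀ Z, Restriction.atName v (ρ Z) = Restriction.atName v Z := by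
        intro Z
        ext s
        simp only [mem_atName, hρ]
        tauto
      have e : ∀ Z, attach (Restriction.atName v (onePart Z)) (ket (zeroPart Z)) = ket (ρ Z) := by
        intro Z
        rw [← attach_ket (ρ Z), hz, ho]
      have hc : ∀ {Z Z' : SysGraph (Fin 2 × S) V},
          (Restriction.atName v).compl Z = (Restriction.atName v).compl Z' ↔
          (Restriction.atName v).compl (onePart Z) = (Restriction.atName v).compl (onePart Z') ∧
          (Restriction.atName v).compl (ρ Z) = (Restriction.atName v).compl (ρ Z') := by
        intro Z Z'
        constructor
        · intro h
          constructor
          · rw [← onePart_atName_compl, h, onePart_atName_compl]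
          · apply ext_parts
            · rw [zeroPart_atName_compl, zeroPart_atName_compl, hz, hz, ← zeroPart_atName_compl,
                ← zeroPart_atName_compl, h]
            · rw [onePart_atName_compl, onePart_atName_compl, ho, ho, atName_compl_atName,
                atName_compl_atName]
        · rintro ⟨h₁, h₂⟩
          apply ext_parts
          · rw [zeroPart_atName_compl, zeroPart_atName_compl, ← hz, ← hz Z',
              ← zeroPart_atName_compl, ← zeroPart_atName_compl, h₂]
          · rw [onePart_atName_compl, onePart_atName_compl, h₁]
      have key : P = toggle {v} Q ↔
          (Restriction.atName v).compl (onePart P) = (Restriction.atName v).compl (onePart Q) ∧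
            ρ P = toggle {v} (ρ Q) := by
        rw [eq_toggle_iff, eq_toggle_iff (X := ρ P), ha, ha, hc]
        tauto
      by_cases hPQ : (Restriction.atName v).compl (onePart P) =
          (Restriction.atName v).compl (onePart Q)
      · rw [if_pos hPQ, entry_toggleBlock, e, e, toggleOp_ket, inner_ket_ket]
        simp only [key, hPQ, true_and]
      · rw [if_neg hPQ, if_neg fun h => hPQ (key.1 h).1]
        simp [entry]
  rw [h]
  split_ifs
  · rfl
  · rw [zero_apply, inner_zero_right]

/-- Conjugating the toggle at `v` by the extension of a causal `U` gives a `ξ_v`-local operator. -/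
theorem isLocal_conj_toggleOp {χ ζ' : Restriction S V} {v : V} {U : Op S V}
    (hnp : IsNamePreserving U) (hc : IsCausal χ ζ' U)
    (hζ : (Restriction.atName v : Restriction S V).Comprehended ζ') {W : Op (Fin 2 × S) V}
    (hW : ∀ X, W (ket X) = attach (onePart X) (U (ket (zeroPart X)))) :
    IsLocal (xi χ v) (star W * toggleOp {v} * W) := by
  classical
  -- The block of `K_v` between given parts with bit `1` is a `χ`-local operator `U† A U`.
  have e : ∀ X Y, entry (star W * toggleOp {v} * W) X Y =
      if (Restriction.atName v).compl (onePart X) = (Restriction.atName v).compl (onePart Y) then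
        entry (star U * toggleBlock v (Restriction.atName v (onePart X))
          (Restriction.atName v (onePart Y)) * U) (zeroPart X) (zeroPart Y) else 0 := by
    intro X Y
    simp only [entry, mul_apply_eq_comp, ContinuousLinearMap.star_eq_adjoint,
      ContinuousLinearMap.adjoint_inner_right, hW]
    exact inner_attach_toggleOp hnp v X Y
  intro Y X
  have hloc := hc.isLocal_conj ((isLocal_toggleBlock v X Y).of_comprehended hζ)
  rw [e, e, onePart_xi, onePart_xi, atName_compl_atName, atName_compl_atName, if_pos rfl,
    atName_atName, atName_atName, zeroPart_xi, zeroPart_xi, hloc, inner_ket_ket, inner_ket_ket]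
  have hcompl : (xi χ v).compl X = (xi χ v).compl Y ↔
      (Restriction.atName v).compl (onePart X) = (Restriction.atName v).compl (onePart Y) ∧
        χ.compl (zeroPart X) = χ.compl (zeroPart Y) := by
    rw [← onePart_xi_compl χ, ← onePart_xi_compl χ, ← zeroPart_xi_compl χ v,
      ← zeroPart_xi_compl χ v]
    exact ⟨fun h => by rw [h]; exact ⟨rfl, rfl⟩, fun h => ext_parts h.2 h.1⟩
  simp only [hcompl, ite_and]
  split_ifs <;> simp

/-! ### The empty graph and the graphs with all bits zero -/

/-- Attaching the empty graph is the identification of `ℋ` with `ℋ'_μ`. -/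
theorem attach_empty : attach (SysGraph.empty (Fin 2 × S) V) = embed S V := by
  apply ext_on_ket
  intro G
  have h := attach_ket G.addZero
  rw [onePart_addZero, zeroPart_addZero] at h
  rw [h, embed_ket]

/-- A name-preserving unitary multiplies the empty graph by a phase. -/
theorem exists_phase {U : Op S V} (hU : U ∈ unitary (Op S V)) (hnp : IsNamePreserving U) :
    ∃ c : ℂ, ‖c‖ = 1 ∧ U (ket (SysGraph.empty S V)) = c • ket (SysGraph.empty S V) := by
  classical
  have h : U (ket (SysGraph.empty S V)) =
      U (ket (SysGraph.empty S V)) (SysGraph.empty S V) • ket (SysGraph.empty S V) := by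
    ext M
    rw [lp.coeFn_smul, Pi.smul_apply, ket_apply]
    by_cases hM : M = SysGraph.empty S V
    · simp [hM]
    · have : U (ket (SysGraph.empty S V)) M = 0 := by
        by_contra hne
        exact hM (eq_empty_of_support (hnp.support_eq hne))
      simp [hM, this]
  refine ⟨_, ?_, h⟩
  have h₂ := norm_apply_of_mem_unitary hU (ket (SysGraph.empty S V))
  rw [h, norm_smul, norm_ket, mul_one] at h₂
  exact h₂

end Attach

end NamedGraph

end

theorem theorem1 {S V : Type*} [Countable S] [Countable V] [Nonempty V]
    (χ ζ' : V → Restriction S V) (U : Op S V)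
    (hU : U ∈ unitary (Op S V)) (hnp : IsNamePreserving U)
    (hcausal : ∀ v, IsCausal (χ v) (ζ' v) U)
    (hζ : ∀ v, (Restriction.atName v : Restriction S V).Comprehended (ζ' v)) :
    ∃ τ K : V → Op (Fin 2 × S) V,
      (∀ v, τ v ∈ unitary (Op (Fin 2 × S) V) ∧ IsStrictlyLocal (Restriction.atName v) (τ v)) ∧
      (∀ v, K v ∈ unitary (Op (Fin 2 × S) V) ∧ IsStrictlyLocal (xi (χ v) v) (K v)) ∧
      ∃ (hτ : ∀ x y, Commute (τ x) (τ y)) (hK : ∀ x y, Commute (K x) (K y))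
        (T P : Op (Fin 2 × S) V),
        IsInfiniteProduct τ hτ T ∧ IsInfiniteProduct K hK P ∧
        ∀ ψ : GraphSpace S V, T (P (embed S V ψ)) = embed S V (U ψ) := by
  classical
  obtain ⟨W, hWu, hW⟩ := exists_unitary_extension hU hnp
  obtain ⟨c, hc, hcU⟩ := exists_phase hU hnp
  obtain ⟨v₀⟩ := ‹Nonempty V›
  have hph : ∀ z : ℂ, ‖z‖ = 1 → ∀ v : V,
      z • toggleOp (S := S) {v} ∈ unitary (Op (Fin 2 × S) V) := by
    intro z hz v
    have hzz : star z * z = 1 := by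
      rw [← starRingEnd_apply, Complex.conj_mul', hz]
      simp
    rw [Unitary.mem_iff, star_smul, star_toggleOp, smul_mul_smul_comm, smul_mul_smul_comm,
      toggleOp_mul_self, mul_comm z, hzz, one_smul, and_self]
  have hKu : ∀ v, star W * toggleOp {v} * W ∈ unitary (Op (Fin 2 × S) V) := fun v =>
    mul_mem (mul_mem (Unitary.star_mem hWu) (toggleOp_mem_unitary _)) hWu
  have hKc : ∀ x y : V, Commute (star W * toggleOp {x} * W) (star W * toggleOp {y} * W) := by
    intro x y
    have key : ∀ A B : Op (Fin 2 × S) V,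
        (star W * A * W) * (star W * B * W) = star W * (A * B) * W := by
      intro A B
      simp only [mul_assoc]
      rw [← mul_assoc W (star W), Unitary.mul_star_self_of_mem hWu, one_mul]
    rw [Commute, SemiconjBy, key, key, (toggleOp_commute {x} {y}).eq]
  -- The phase of the empty graph is carried by the toggle at the single name `v₀`.
  refine ⟨fun v => (if v = v₀ then c else 1) • toggleOp {v}, fun v => star W * toggleOp {v} * W,
    fun v => ?_, fun v => ⟨hKu v, (isLocal_conj_toggleOp hnp (hcausal v) (hζ v)
      hW).strict_of_unitary (hKu v)⟩,
    fun x y => ((toggleOp_commute _ _).smul_left _).smul_right _, hKc,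
    c • toggleOp Set.univ, star W * toggleOp Set.univ * W, ?_, ?_, ?_⟩
  · have := hph (if v = v₀ then c else 1) (by split_ifs <;> simp [hc]) v
    exact ⟨this, ((isLocal_toggleOp v).smul _).strict_of_unitary this⟩
  · intro ψ
    refine ((tendsto_toggleOp ψ).const_smul c).congr' ?_
    filter_upwards [Filter.eventually_ge_atTop {v₀}] with F hF
    refine Eq.trans ?_ (congrArg (fun A : Op (Fin 2 × S) V => A ψ)
      (noncommProd_smul_toggleOp (S := S) (fun v => if v = v₀ then c else 1) F _)).symm
    rw [Finset.prod_ite_eq', if_pos (hF (Finset.mem_singleton_self _)), smul_apply]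
  · intro ψ
    have hT : ∀ F : Finset V, F.noncommProd (fun v => toggleOp (S := S) {v})
        (fun x _ y _ _ => toggleOp_commute _ _) = toggleOp (F : Set V) := by
      intro F
      have h := noncommProd_smul_toggleOp (S := S) (fun _ : V => (1 : ℂ)) F
        fun x _ y _ _ => ((toggleOp_commute _ _).smul_left _).smul_right _
      simpa only [one_smul, Finset.prod_const_one] using h
    refine (((star W : Op (Fin 2 × S) V).continuous.tendsto _).comp
      (tendsto_toggleOp (W ψ))).congr fun F => ?_
    refine Eq.trans ?_ (congrArg (fun A : Op (Fin 2 × S) V => A ψ) (noncommProd_conj hWu _ F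
      (fun x _ y _ _ => toggleOp_commute _ _) _)).symm
    rw [hT]
    rfl
  · intro ψ
    have hWe : ∀ ψ, W (embed S V ψ) = embed S V (U ψ) := by
      have : W ∘L embed S V = embed S V ∘L U := by
        apply ext_on_ket
        intro G
        rw [ContinuousLinearMap.comp_apply, ContinuousLinearMap.comp_apply, embed_ket, hW,
          onePart_addZero, zeroPart_addZero, attach_empty]
      exact fun ψ => congrArg (fun A => A ψ) this
    -- On graphs all of whose bits are `1`, the extension `W` of `U` is the scalar `c`.
    have hback : (c • toggleOp Set.univ * (star W * toggleOp Set.univ)) ∘L embed S V =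
        embed S V := by
      apply ext_on_ket
      intro G
      have h₁ : W (ket (toggle Set.univ G.addZero)) = c • ket (toggle Set.univ G.addZero) := by
        rw [hW, zeroPart_toggle_univ_addZero, hcU, map_smul, ← zeroPart_toggle_univ_addZero G,
          attach_ket]
      have h₂ := congrArg (star W : Op (Fin 2 × S) V) h₁
      rw [← mul_apply_eq_comp, Unitary.star_mul_self_of_mem hWu, one_apply_eq_self,
        map_smul] at h₂
      simp only [ContinuousLinearMap.comp_apply, mul_apply_eq_comp, embed_ket,
        toggleOp_ket, smul_apply]
      rw [← map_smul, ← h₂, toggleOp_ket, toggle_toggle]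
    have := congrArg (fun A => A (U ψ)) hback
    simp only [ContinuousLinearMap.comp_apply, mul_apply_eq_comp] at this
    simp only [mul_apply_eq_comp, hWe]
    exact this
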